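/- Let $\mu$ be a probability measure on the unit circle $\partial\mathbb{D}=\{z\in\mathbb{C}:|z|=1\}$ that is nontrivial (i.e., not a finite combination of point masses), and write $d\mu = w(\theta)\,\frac{d\theta}{2\pi}+d\mu_{\mathrm{s}}$ with $w\in L^1(\partial\mathbb{D},\frac{d\theta}{2\pi})$, $w\ge 0$, and $\mu_{\mathrm{s}}$ singular with respect to $\frac{d\theta}{2\pi}$. For $n\ge 0$ let $\Phi_n$ be the monic polynomial of degree $n$ that is orthogonal to $1,z,\dots,z^{n-1}$ in $L^2(\partial\mathbb{D},d\mu)$, and let $\alpha_n=-\overline{\Phi_{n+1}(0)}$, $n\ge 0$, be the Verblunsky coefficients of $\mu$. Then $$\sum_{j=0}^\infty |\alpha_{j+1}-\alpha_j|^2+\sum_{j=0}^\infty|\alpha_j|^4<\infty \quad\Longleftrightarrow\quad \int_0^{2\pi}(1-\cos\theta)\,\log w(\theta)\,\frac{d\theta}{2\pi}>-\infty .$$ Here $\log 0=-\infty$, and the integral on the right always exists in $[-\infty,\infty)$, since the positive part of the integrand is at most $2w$. -/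

import Mathlib

namespace OPUC

open MeasureTheory Polynomial ComplexConjugate
open scoped ENNReal

noncomputable section

instance : MeasurableSpace Circle := borel Circle

instance : BorelSpace Circle := ⟨rfl⟩

/-- The measure `dθ/2π` on the interval `(0, 2π]` of angles. -/
def angleMeasure : Measure ℝ :=
  ENNReal.ofReal (2 * Real.pi)⁻¹ • volume.restrict (Set.Ioc 0 (2 * Real.pi))

/-- Normalized Lebesgue measure `dθ/2π` on the unit circle: the image of `angleMeasure` under
`θ ↦ exp (iθ)`. -/
def circleMeasure : Measure Circle := angleMeasure.map Circle.exp

/-- A measure on the unit circle is nontrivial if it is not a finite combination of point masses,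
that is, if it is not concentrated on any finite set. -/
def IsNontrivial (μ : Measure Circle) : Prop :=
  ∀ s : Set Circle, s.Finite → μ sᶜ ≠ 0

/-- The inner product of `L²(μ)` on polynomials, conjugate linear in the first argument. -/
def polyInner (μ : Measure Circle) (p q : ℂ[X]) : ℂ :=
  ∫ z : Circle, conj (p.eval (z : ℂ)) * q.eval (z : ℂ) ∂μ

/-- The monic orthogonal polynomials `Φ₀, Φ₁, …` of `μ`: Gram-Schmidt orthogonalization, without
normalization, of `1, X, X², …` in `L²(μ)`. -/
def monicOP (μ : Measure Circle) : ℕ → ℂ[X]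
  | n => X ^ n - ∑ k : Fin n,
      C (polyInner μ (monicOP μ k) (X ^ n) / polyInner μ (monicOP μ k) (monicOP μ k)) *
        monicOP μ k
  termination_by n => n
  decreasing_by all_goals exact k.isLt

/-- The Verblunsky coefficients `αₙ`, minus the complex conjugate of `Φₙ₊₁(0)`. -/
def verblunsky (μ : Measure Circle) (n : ℕ) : ℂ :=
  -conj ((monicOP μ (n + 1)).eval 0)

/-- The density `w` of the absolutely continuous part of `μ`, in the Lebesgue decomposition
`dμ = w dθ/2π + dμₛ`, as a function of the angle `θ`. -/
def weight (μ : Measure Circle) (θ : ℝ) : ℝ≥0∞ :=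
  μ.rnDeriv circleMeasure (Circle.exp θ)

/-- The integral of a function with values in `[-∞, ∞]`: the integral of the positive part minus
the integral of the negative part. It is used only where the former is finite. -/
def extIntegral {Ω : Type*} [MeasurableSpace Ω] (ν : Measure Ω) (f : Ω → EReal) : EReal :=
  ((∫⁻ x, (f x).toENNReal ∂ν : ℝ≥0∞) : EReal) - ((∫⁻ x, (-f x).toENNReal ∂ν : ℝ≥0∞) : EReal)

/-- The integral `∫ (1 - cos θ) log w(θ) dθ/2π` over one period, in `[-∞, ∞)`; here `log 0 = -∞`.
Since `log w ≤ w` and `w` is integrable for finite `μ`, its positive part is finite. -/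
def higherSzegoIntegral (μ : Measure Circle) : EReal :=
  extIntegral angleMeasure
    (fun θ => ((1 - Real.cos θ : ℝ) : EReal) * ENNReal.log (weight μ θ))

end

end OPUC

/-! Write c = 1 - cos θ, and let μₙ be the Bernstein-Szegő measure with density wₙ = ‖Φₙ‖² |Φₙ|⁻²,
which has the moments of μ up to order n. All zeros of Φₙ lie in the open disc, so Zₙ = ∫ c log wₙ
is computed by the mean value property: it is log ‖Φₙ‖² plus the real part of the subleading
coefficient of Φₙ. The Szegő recursion gives Zₙ₊₂ - Zₙ₊₁ = log(1 - |αₙ₊₁|²) + Re(conj αₙ₊₁ αₙ).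
Completing the square turns this into a telescoping difference of |αⱼ|²/2 minus a nonnegative term
comparable to |αₙ₊₁ - αₙ|² + |αₙ₊₁|⁴. Hence the Zₙ are bounded below exactly when both series
converge (`exists_le_finiteSzegoIntegral_iff`).

It remains to compare inf Zₙ with the integral for μ, and log x ≤ x - 1 serves both directions. With
x = w |Φₙ|² / ‖Φₙ‖² it yields Zₙ ≥ ∫ c log w - 1, since ∫ w |Φₙ|² ≤ ‖Φₙ‖²
(`exists_le_finiteSzegoIntegral_of_lintegral_lt_top`). Conversely, x = f wₙ with f continuous and
positive gives ∫ c log f ≤ ∫ c f dμₙ - 1 - Zₙ. Weak convergence μₙ → μ and density of continuous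
functions in L¹ replace μₙ by μ and f by a bounded measurable g ≥ 1. Choosing g as a truncation of
1/w away from the singular part, and applying Fatou, bounds the negative part of c log w
(`lintegral_lt_top_of_le_finiteSzegoIntegral`). -/

namespace OPUC

open MeasureTheory Polynomial ComplexConjugate
open scoped ENNReal

noncomputable section

/-! ### The sesquilinear form of μ on polynomials -/

section InnerProduct

variable {μ : Measure Circle}

theorem integrable_of_continuous [IsFiniteMeasure μ] {E : Type*} [NormedAddCommGroup E] {f : Circle → E}
    (hf : Continuous f) : Integrable f μ :=
  hf.integrable_of_hasCompactSupport (HasCompactSupport.of_compactSpace f)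

theorem continuous_eval_circle (p : ℂ[X]) : Continuous fun z : Circle => p.eval (z : ℂ) :=
  p.continuous.comp continuous_subtype_val

theorem continuous_polyInner_integrand (p q : ℂ[X]) :
    Continuous fun z : Circle => conj (p.eval (z : ℂ)) * q.eval (z : ℂ) :=
  (Complex.continuous_conj.comp (continuous_eval_circle p)).mul (continuous_eval_circle q)

theorem polyInner_add_right [IsFiniteMeasure μ] (p q r : ℂ[X]) :
    polyInner μ p (q + r) = polyInner μ p q + polyInner μ p r := by
  unfold polyInner
  rw [← integral_add (integrable_of_continuous (continuous_polyInner_integrand p q))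
    (integrable_of_continuous (continuous_polyInner_integrand p r))]
  simp only [eval_add, mul_add]

theorem polyInner_C_mul_right (p q : ℂ[X]) (c : ℂ) :
    polyInner μ p (C c * q) = c * polyInner μ p q := by
  unfold polyInner
  rw [← integral_const_mul]
  simp only [eval_mul, eval_C, mul_left_comm]

theorem polyInner_conj_symm (p q : ℂ[X]) : conj (polyInner μ p q) = polyInner μ q p := by
  unfold polyInner
  rw [← integral_conj]
  simp [mul_comm]

theorem polyInner_add_left [IsFiniteMeasure μ] (p q r : ℂ[X]) :
    polyInner μ (p + q) r = polyInner μ p r + polyInner μ q r := by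
  rw [← polyInner_conj_symm, polyInner_add_right, map_add, polyInner_conj_symm,
    polyInner_conj_symm]

theorem polyInner_C_mul_left (p q : ℂ[X]) (c : ℂ) :
    polyInner μ (C c * p) q = conj c * polyInner μ p q := by
  rw [← polyInner_conj_symm, polyInner_C_mul_right, map_mul, polyInner_conj_symm]

@[simp] theorem polyInner_zero_right (p : ℂ[X]) : polyInner μ p 0 = 0 := by simp [polyInner]

@[simp] theorem polyInner_zero_left (p : ℂ[X]) : polyInner μ 0 p = 0 := by simp [polyInner]

theorem polyInner_sub_right [IsFiniteMeasure μ] (p q r : ℂ[X]) :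
    polyInner μ p (q - r) = polyInner μ p q - polyInner μ p r := by
  have h := polyInner_add_right (μ := μ) p (q - r) r
  rw [sub_add_cancel] at h
  rw [h, add_sub_cancel_right]

theorem polyInner_sum_right [IsFiniteMeasure μ] {ι : Type*} (s : Finset ι) (p : ℂ[X]) (f : ι → ℂ[X]) :
    polyInner μ p (∑ i ∈ s, f i) = ∑ i ∈ s, polyInner μ p (f i) := by
  classical
  induction s using Finset.induction_on with
  | empty => simp
  | insert a s ha ih => rw [Finset.sum_insert ha, Finset.sum_insert ha, polyInner_add_right, ih]

theorem polyInner_X_mul_X_mul (p q : ℂ[X]) : polyInner μ (X * p) (X * q) = polyInner μ p q := by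
  unfold polyInner
  congr 1
  funext z
  have hz : conj (z : ℂ) * z = 1 := by
    rw [mul_comm, Complex.mul_conj, Circle.normSq_coe, Complex.ofReal_one]
  simp only [eval_mul, eval_X, map_mul]
  linear_combination (conj (p.eval (z : ℂ)) * q.eval (z : ℂ)) * hz

/-- The square of the norm of a polynomial in `L²(μ)`. -/
def sqNorm (μ : Measure Circle) (p : ℂ[X]) : ℝ := ∫ z : Circle, ‖p.eval (z : ℂ)‖ ^ 2 ∂μ

theorem polyInner_self (p : ℂ[X]) : polyInner μ p p = (sqNorm μ p : ℂ) := by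
  unfold polyInner sqNorm
  rw [← integral_complex_ofReal]
  congr 1
  funext z
  rw [mul_comm, Complex.mul_conj, Complex.normSq_eq_norm_sq]

theorem sqNorm_nonneg (p : ℂ[X]) : 0 ≤ sqNorm μ p :=
  integral_nonneg fun _ => by positivity

/-- A nonzero polynomial has finitely many zeros, and a nontrivial measure charges the complement of
any finite set. -/
theorem sqNorm_pos [IsFiniteMeasure μ] (hμ : IsNontrivial μ) {p : ℂ[X]} (hp : p ≠ 0) : 0 < sqNorm μ p := by
  refine lt_of_le_of_ne (sqNorm_nonneg p) fun h => ?_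
  have hint : Integrable (fun z : Circle => ‖p.eval (z : ℂ)‖ ^ 2) μ :=
    integrable_of_continuous ((continuous_eval_circle p).norm.pow 2)
  have h0 := (integral_eq_zero_iff_of_nonneg (fun _ => by positivity) hint).1 h.symm
  have hfin : ((fun z : Circle => (z : ℂ)) ⁻¹' (p.roots.toFinset : Set ℂ)).Finite :=
    (Finset.finite_toSet _).preimage Circle.coe_injective.injOn
  refine hμ _ hfin (measure_mono_null ?_ h0)
  intro z hz hz'
  refine hz ?_
  have : p.eval (z : ℂ) = 0 := by simpa using hz'
  simpa [hp] using this

theorem sqNorm_add_of_orthogonal [IsFiniteMeasure μ] {p q : ℂ[X]} (h : polyInner μ p q = 0) :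
    sqNorm μ (p + q) = sqNorm μ p + sqNorm μ q := by
  have h' : polyInner μ q p = 0 := by rw [← polyInner_conj_symm, h, map_zero]
  have := polyInner_self (μ := μ) (p + q)
  rw [polyInner_add_left, polyInner_add_right, polyInner_add_right, h, h', polyInner_self,
    polyInner_self] at this
  exact_mod_cast (by linear_combination -this :
    (sqNorm μ (p + q) : ℂ) = sqNorm μ p + sqNorm μ q)

theorem sqNorm_C_mul (c : ℂ) (p : ℂ[X]) : sqNorm μ (C c * p) = ‖c‖ ^ 2 * sqNorm μ p := by
  unfold sqNorm
  rw [← integral_const_mul]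
  simp [mul_pow]

theorem sqNorm_X_mul (p : ℂ[X]) : sqNorm μ (X * p) = sqNorm μ p := by
  unfold sqNorm
  simp [Circle.norm_coe]

theorem polyInner_X_pow_add (p : ℂ[X]) (k : ℕ) :
    polyInner μ (X ^ (k + 1)) (X * p) = polyInner μ (X ^ k) p := by
  rw [pow_succ', polyInner_X_mul_X_mul]

/-- A polynomial orthogonal to `1, X, …, X ^ (n - 1)` is orthogonal to all polynomials of degree
less than `n`. -/
theorem polyInner_eq_zero_of_degree_lt [IsFiniteMeasure μ] {n : ℕ} {q : ℂ[X]}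
    (hq : ∀ k < n, polyInner μ (X ^ k) q = 0) {p : ℂ[X]} (hp : p.degree < n) :
    polyInner μ p q = 0 := by
  rw [← polyInner_conj_symm, p.as_sum_range_C_mul_X_pow, polyInner_sum_right, map_sum]
  refine Finset.sum_eq_zero fun k _ => ?_
  rw [polyInner_conj_symm, polyInner_C_mul_left]
  rcases lt_or_ge k n with hk | hk
  · rw [hq k hk, mul_zero]
  · rw [coeff_eq_zero_of_degree_lt (hp.trans_le (by exact_mod_cast hk)), map_zero, zero_mul]

end InnerProduct

/-! ### Reversed polynomials -/

section Reversed

/-- The reversed polynomial `p*` of a polynomial of degree at most `n`: `zⁿ conj (p (1 / conj z))`. -/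
def revConj (n : ℕ) (p : ℂ[X]) : ℂ[X] := reflect n (p.map (starRingEnd ℂ))

theorem natDegree_revConj_le {n : ℕ} {p : ℂ[X]} (hp : p.natDegree ≤ n) :
    (revConj n p).natDegree ≤ n := by
  refine natDegree_reflect_le.trans ?_
  simp [hp]

theorem coeff_revConj {n i : ℕ} (hi : i ≤ n) (p : ℂ[X]) :
    (revConj n p).coeff i = conj (p.coeff (n - i)) := by
  rw [revConj, coeff_reflect, revAt_le hi, coeff_map]

theorem eval_revConj_of_ne_zero {n : ℕ} {p : ℂ[X]} (hp : p.natDegree ≤ n) {z : ℂ} (hz : z ≠ 0) :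
    (revConj n p).eval z = z ^ n * conj (p.eval (conj z)⁻¹) := by
  have : Invertible z⁻¹ := invertibleOfNonzero (inv_ne_zero hz)
  have h := eval₂_reflect_mul_pow (RingHom.id ℂ) z⁻¹ n (p.map (starRingEnd ℂ)) (by simpa using hp)
  simp only [invOf_eq_inv, inv_inv, eval₂_id] at h
  have h2 : (p.map (starRingEnd ℂ)).eval z⁻¹ = conj (p.eval (conj z)⁻¹) := by
    rw [eval_map, ← map_inv₀, ← Complex.conj_conj z⁻¹, eval₂_hom, Complex.conj_conj]
  rw [← h2, ← h, revConj, mul_left_comm, ← mul_pow, mul_inv_cancel₀ hz, one_pow, mul_one]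

theorem eval_revConj_circle {n : ℕ} {p : ℂ[X]} (hp : p.natDegree ≤ n) (z : Circle) :
    (revConj n p).eval (z : ℂ) = (z : ℂ) ^ n * conj (p.eval (z : ℂ)) := by
  rw [eval_revConj_of_ne_zero hp z.coe_ne_zero]
  congr 3
  rw [← Circle.coe_inv_eq_conj, Circle.coe_inv, inv_inv]

theorem revConj_sub (n : ℕ) (p q : ℂ[X]) : revConj n (p - q) = revConj n p - revConj n q := by
  simp [revConj, reflect_sub]

theorem revConj_C_mul (n : ℕ) (c : ℂ) (p : ℂ[X]) :
    revConj n (C c * p) = C (conj c) * revConj n p := by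
  simp [revConj, reflect_C_mul]

theorem revConj_succ_X_mul {n : ℕ} {p : ℂ[X]} (hp : p.natDegree ≤ n) :
    revConj (n + 1) (X * p) = revConj n p := by
  have h := reflect_mul (X : ℂ[X]) (p.map (starRingEnd ℂ)) (F := 1) (G := n)
    natDegree_X_le (by simpa using hp)
  rw [revConj, Polynomial.map_mul, map_X, add_comm n 1, h, reflect_one_X, one_mul, revConj]

theorem revConj_succ_revConj (n : ℕ) (p : ℂ[X]) (hp : p.natDegree ≤ n) :
    revConj (n + 1) (revConj n p) = X * p := by
  have h := revConj_succ_X_mul hp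
  rw [← h, revConj, revConj, ← reflect_map, reflect_reflect, Polynomial.map_map]
  simp

variable {μ : Measure Circle}

theorem sqNorm_revConj {n : ℕ} {p : ℂ[X]} (hp : p.natDegree ≤ n) :
    sqNorm μ (revConj n p) = sqNorm μ p := by
  unfold sqNorm
  simp [eval_revConj_circle hp, Circle.norm_coe]

theorem polyInner_X_pow_revConj {n k : ℕ} (hk : k ≤ n) {p : ℂ[X]} (hp : p.natDegree ≤ n) :
    polyInner μ (X ^ k) (revConj n p) = conj (polyInner μ (X ^ (n - k)) p) := by
  unfold polyInner
  rw [← integral_conj]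
  congr 1
  funext z
  have hz : conj (z : ℂ) * z = 1 := by
    rw [mul_comm, Complex.mul_conj, Circle.normSq_coe, Complex.ofReal_one]
  obtain ⟨j, rfl⟩ := Nat.exists_eq_add_of_le hk
  simp only [eval_revConj_circle hp, eval_pow, eval_X, map_mul, map_pow, Complex.conj_conj,
    Nat.add_sub_cancel_left, pow_add]
  have hzk : conj (z : ℂ) ^ k * (z : ℂ) ^ k = 1 := by rw [← mul_pow, hz, one_pow]
  linear_combination ((z : ℂ) ^ j * conj (p.eval (z : ℂ))) * hzk

end Reversed

/-! ### Orthogonal polynomials, the Szegő recursion and location of zeros -/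

section MonicOP

variable {μ : Measure Circle}

theorem monicOP_eq (μ : Measure Circle) (n : ℕ) :
    monicOP μ n = X ^ n - ∑ k : Fin n, C (polyInner μ (monicOP μ k) (X ^ n) /
      polyInner μ (monicOP μ k) (monicOP μ k)) * monicOP μ k := by
  rw [monicOP]

/-- The three claims are proved by one strong induction because the bound on the correction needs
the degrees of all earlier polynomials. -/
theorem monicOP_correction_degree_lt_and_monic (n : ℕ) :
    (∑ k : Fin n, C (polyInner μ (monicOP μ k) (X ^ n) / polyInner μ (monicOP μ k) (monicOP μ k)) *
        monicOP μ k).degree < n ∧ (monicOP μ n).Monic ∧ (monicOP μ n).natDegree = n := by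
  induction n using Nat.strong_induction_on with
  | _ n ih =>
    have h : (∑ k : Fin n, C (polyInner μ (monicOP μ k) (X ^ n) /
        polyInner μ (monicOP μ k) (monicOP μ k)) * monicOP μ k).degree < n := by
      rw [← mem_degreeLT]
      refine Submodule.sum_mem _ fun k _ => ?_
      rw [← smul_eq_C_mul]
      refine Submodule.smul_mem _ _ (mem_degreeLT.2 ?_)
      refine degree_le_natDegree.trans_lt ?_
      rw [(ih k k.isLt).2.2]
      exact_mod_cast k.isLt
    have hm : (monicOP μ n).Monic ∧ (monicOP μ n).natDegree = n := by
      rw [monicOP, sub_eq_add_neg]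
      rw [← degree_neg] at h
      refine ⟨monic_X_pow_add h, ?_⟩
      rw [natDegree_add_eq_left_of_degree_lt (by rwa [degree_X_pow]), natDegree_X_pow]
    exact ⟨h, hm⟩

theorem monic_monicOP (n : ℕ) : (monicOP μ n).Monic := (monicOP_correction_degree_lt_and_monic n).2.1

@[simp] theorem natDegree_monicOP (n : ℕ) : (monicOP μ n).natDegree = n :=
  (monicOP_correction_degree_lt_and_monic n).2.2

theorem monicOP_ne_zero (n : ℕ) : monicOP μ n ≠ 0 := (monic_monicOP n).ne_zero

variable [IsFiniteMeasure μ]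

theorem polyInner_monicOP_of_lt (hμ : IsNontrivial μ) (n : ℕ) :
    ∀ j < n, polyInner μ (monicOP μ j) (monicOP μ n) = 0 := by
  induction n using Nat.strong_induction_on with
  | _ n ih =>
    intro j hj
    have hself : polyInner μ (monicOP μ j) (monicOP μ j) ≠ 0 := by
      rw [polyInner_self]
      exact_mod_cast (sqNorm_pos hμ (monicOP_ne_zero j)).ne'
    rw [monicOP_eq μ n, polyInner_sub_right, polyInner_sum_right, Finset.sum_eq_single (⟨j, hj⟩ : Fin n)]
    · rw [polyInner_C_mul_right, div_mul_cancel₀ _ hself, sub_self]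
    · intro k _ hk
      rw [polyInner_C_mul_right]
      have hk' : (k : ℕ) ≠ j := fun h => hk (Fin.ext h)
      rcases lt_or_gt_of_ne hk' with h | h
      · rw [← polyInner_conj_symm (monicOP μ k) (monicOP μ j), ih j hj k h, map_zero, mul_zero]
      · rw [ih k k.isLt j h, mul_zero]
    · simp

/-- The monic orthogonal polynomial of degree `n` is orthogonal to all polynomials of degree less
than `n`. -/
theorem polyInner_monicOP_of_degree_lt (hμ : IsNontrivial μ) {n : ℕ} {p : ℂ[X]}
    (hp : p.degree < n) : polyInner μ p (monicOP μ n) = 0 := by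
  have key : ∀ d ≤ n, ∀ p : ℂ[X], p.degree < d → polyInner μ p (monicOP μ n) = 0 := by
    intro d
    induction d with
    | zero =>
      intro _ p hp
      have : p = 0 := by simpa using hp
      rw [this, polyInner_zero_left]
    | succ d ih =>
      intro hd p hp
      have hlow : (p - C (p.coeff d) * monicOP μ d).degree < d := by
        rw [degree_lt_iff_coeff_zero] at hp ⊢
        intro m hm
        rcases hm.eq_or_lt with rfl | hm
        · have : (monicOP μ d).coeff d = 1 := by
            simpa [Monic, leadingCoeff] using monic_monicOP (μ := μ) d
          simp [this]
        · rw [coeff_sub, coeff_C_mul, hp m hm, coeff_eq_zero_of_natDegree_lt (p := monicOP μ d)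
            (by rwa [natDegree_monicOP])]
          simp
      have := ih (by omega) _ hlow
      rw [← sub_add_cancel p (C (p.coeff d) * monicOP μ d), polyInner_add_left, this,
        polyInner_C_mul_left, polyInner_monicOP_of_lt hμ n d (by omega), mul_zero, add_zero]
  exact key n le_rfl p hp

theorem polyInner_X_pow_monicOP (hμ : IsNontrivial μ) {n k : ℕ} (hk : k < n) :
    polyInner μ (X ^ k) (monicOP μ n) = 0 :=
  polyInner_monicOP_of_degree_lt hμ (by rw [degree_X_pow]; exact_mod_cast hk)

/-- The reversed orthogonal polynomial is orthogonal to `X, …, X ^ n`. -/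
theorem polyInner_X_pow_revConj_monicOP (hμ : IsNontrivial μ) {n k : ℕ} (hk : 1 ≤ k)
    (hkn : k ≤ n) : polyInner μ (X ^ k) (revConj n (monicOP μ n)) = 0 := by
  rw [polyInner_X_pow_revConj hkn (by simp), polyInner_X_pow_monicOP hμ (by omega), map_zero]

theorem monicOP_succ_coeff_zero (μ : Measure Circle) (n : ℕ) :
    (monicOP μ (n + 1)).coeff 0 = -conj (verblunsky μ n) := by
  rw [verblunsky, coeff_zero_eq_eval_zero]
  simp

theorem revConj_monicOP_coeff_zero (μ : Measure Circle) (n : ℕ) :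
    (revConj n (monicOP μ n)).coeff 0 = 1 := by
  have : (monicOP μ n).coeff n = 1 := by
    simpa [Monic, leadingCoeff] using monic_monicOP (μ := μ) n
  rw [coeff_revConj (Nat.zero_le n), Nat.sub_zero, this, map_one]

/-- **Szegő recursion.** -/
theorem monicOP_succ (hμ : IsNontrivial μ) (n : ℕ) :
    monicOP μ (n + 1) = X * monicOP μ n -
      C (conj (verblunsky μ n)) * revConj n (monicOP μ n) := by
  set S : ℂ[X] := revConj n (monicOP μ n) with hS
  have hSdeg : S.natDegree ≤ n := natDegree_revConj_le (by simp)
  set Q : ℂ[X] := monicOP μ (n + 1) - X * monicOP μ n + C (conj (verblunsky μ n)) * S with hQ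
  suffices hQ0 : Q = 0 by
    rw [hQ] at hQ0
    linear_combination hQ0
  have hQdeg : Q.degree < (n + 1 : ℕ) := by
    rw [hQ]
    refine (degree_add_le _ _).trans_lt (max_lt ?_ ?_)
    · have h1 : (monicOP μ (n + 1)).degree = ((n + 1 : ℕ) : WithBot ℕ) := by
        rw [degree_eq_natDegree (monicOP_ne_zero _), natDegree_monicOP]
      have h2 : (X * monicOP μ n).degree = ((n + 1 : ℕ) : WithBot ℕ) := by
        rw [degree_mul, degree_X, degree_eq_natDegree (monicOP_ne_zero _), natDegree_monicOP]
        push_cast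
        rw [add_comm]
      rw [← h1]
      refine degree_sub_lt_left (by rw [h1, h2]) (monicOP_ne_zero _) ?_
      rw [monic_monicOP, Monic.leadingCoeff (monic_X.mul (monic_monicOP n))]
    · rw [← smul_eq_C_mul]
      refine (degree_smul_le _ _).trans_lt (degree_le_natDegree.trans_lt ?_)
      exact_mod_cast Nat.lt_succ_of_le hSdeg
  -- By definition of the Verblunsky coefficient the constant term of Q cancels. So Q = X R with deg
  -- R < n, and R inherits orthogonality to 1, …, X ^ (n - 1); thus R is orthogonal to itself.
  have hQ0 : Q.coeff 0 = 0 := by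
    simp [hQ, hS, monicOP_succ_coeff_zero, revConj_monicOP_coeff_zero]
  obtain ⟨R, hR⟩ := X_dvd_iff.2 hQ0
  have hRdeg : R.degree < n := by
    rw [degree_lt_iff_coeff_zero] at hQdeg ⊢
    intro m hm
    rw [← hQdeg (m + 1) (by omega), hR, coeff_X_mul]
  have horth : ∀ k < n, polyInner μ (X ^ k) R = 0 := by
    intro k hk
    rw [← polyInner_X_pow_add, ← hR, hQ, polyInner_add_right, polyInner_sub_right,
      polyInner_C_mul_right, polyInner_X_pow_add, polyInner_X_pow_monicOP hμ (by omega),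
      polyInner_X_pow_monicOP hμ hk, polyInner_X_pow_revConj_monicOP hμ (by omega) (by omega)]
    simp
  have hRR := polyInner_eq_zero_of_degree_lt horth hRdeg
  by_contra hne
  have hRne : R ≠ 0 := fun h => hne (by rw [hR, h, mul_zero])
  rw [polyInner_self] at hRR
  exact (sqNorm_pos hμ hRne).ne' (by exact_mod_cast hRR)

/-- Pythagoras in the Szegő recursion: Φₙ₊₁ is orthogonal to Φₙ*, while multiplication by z and
reversal preserve the norm. -/
theorem sqNorm_monicOP_succ (hμ : IsNontrivial μ) (n : ℕ) :
    sqNorm μ (monicOP μ (n + 1)) = (1 - ‖verblunsky μ n‖ ^ 2) * sqNorm μ (monicOP μ n) := by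
  have h := monicOP_succ hμ n
  have hX : X * monicOP μ n = C (conj (verblunsky μ n)) * revConj n (monicOP μ n) +
      monicOP μ (n + 1) := by rw [h]; ring
  have horth : polyInner μ (C (conj (verblunsky μ n)) * revConj n (monicOP μ n))
      (monicOP μ (n + 1)) = 0 := by
    rw [polyInner_C_mul_left, polyInner_monicOP_of_degree_lt hμ, mul_zero]
    refine degree_le_natDegree.trans_lt ?_
    exact_mod_cast Nat.lt_succ_of_le (natDegree_revConj_le (by simp))
  have hn := sqNorm_add_of_orthogonal horth
  rw [← hX, sqNorm_X_mul, sqNorm_C_mul, sqNorm_revConj (by simp), RCLike.norm_conj] at hn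
  linarith

theorem norm_verblunsky_lt_one (hμ : IsNontrivial μ) (n : ℕ) : ‖verblunsky μ n‖ < 1 := by
  have h1 := sqNorm_pos hμ (monicOP_ne_zero (μ := μ) (n + 1))
  rw [sqNorm_monicOP_succ hμ] at h1
  have h2 := pos_of_mul_pos_left h1 (sqNorm_nonneg _)
  nlinarith [norm_nonneg (verblunsky μ n)]

/-- The coefficient of `X ^ (n - 1)` in the monic orthogonal polynomial of degree `n`. -/
theorem nextCoeff_monicOP_succ (hμ : IsNontrivial μ) (n : ℕ) :
    (monicOP μ (n + 1)).nextCoeff = (monicOP μ n).nextCoeff -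
      conj (verblunsky μ n) * conj ((monicOP μ n).coeff 0) := by
  rw [nextCoeff_of_natDegree_pos (by simp), natDegree_monicOP, Nat.add_sub_cancel,
    monicOP_succ hμ, coeff_sub, coeff_C_mul, coeff_revConj le_rfl, Nat.sub_self]
  cases n with
  | zero => simp [nextCoeff]
  | succ n => rw [coeff_X_mul, nextCoeff_of_natDegree_pos (by simp), natDegree_monicOP,
      Nat.add_sub_cancel]

/-- The zeros of the orthogonal polynomials lie in the open unit disc. -/
theorem norm_lt_one_of_isRoot_monicOP (hμ : IsNontrivial μ) {n : ℕ} {a : ℂ}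
    (ha : (monicOP μ n).IsRoot a) : ‖a‖ < 1 := by
  obtain ⟨p, hp⟩ := dvd_iff_isRoot.2 ha
  have hp0 : p ≠ 0 := fun h => monicOP_ne_zero (μ := μ) n (by rw [hp, h, mul_zero])
  -- With Φₙ = (X - a) p this splitting is orthogonal, so ‖p‖² = |a|² ‖p‖² + ‖Φₙ‖², which forces |a|
  -- < 1.
  have hX : X * p = C a * p + monicOP μ n := by rw [hp]; ring
  have hdeg : p.degree < n := by
    have h := natDegree_mul (X_sub_C_ne_zero a) hp0
    rw [← hp, natDegree_monicOP, natDegree_X_sub_C] at h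
    refine degree_le_natDegree.trans_lt ?_
    exact_mod_cast (by omega : p.natDegree < n)
  have horth : polyInner μ (C a * p) (monicOP μ n) = 0 := by
    rw [polyInner_C_mul_left, polyInner_monicOP_of_degree_lt hμ hdeg, mul_zero]
  have hn := sqNorm_add_of_orthogonal horth
  rw [← hX, sqNorm_X_mul, sqNorm_C_mul] at hn
  have h1 := sqNorm_pos hμ hp0
  have h2 := sqNorm_pos hμ (monicOP_ne_zero (μ := μ) n)
  by_contra! h
  nlinarith [mul_le_mul_of_nonneg_right (one_le_pow₀ h : 1 ≤ ‖a‖ ^ 2) h1.le]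

theorem eval_revConj_monicOP_ne_zero (hμ : IsNontrivial μ) (n : ℕ) {z : ℂ} (hz : ‖z‖ ≤ 1) :
    (revConj n (monicOP μ n)).eval z ≠ 0 := by
  rcases eq_or_ne z 0 with rfl | h0
  · rw [← coeff_zero_eq_eval_zero, revConj_monicOP_coeff_zero]
    exact one_ne_zero
  · rw [eval_revConj_of_ne_zero (by simp) h0]
    refine mul_ne_zero (pow_ne_zero _ h0) fun h => ?_
    have hroot : (monicOP μ n).IsRoot (conj z)⁻¹ := (map_eq_zero _).1 h
    have := norm_lt_one_of_isRoot_monicOP hμ hroot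
    rw [norm_inv, RCLike.norm_conj] at this
    exact absurd (one_le_inv_iff₀.2 ⟨norm_pos_iff.2 h0, hz⟩) (not_le.2 this)

theorem eval_monicOP_circle_ne_zero (hμ : IsNontrivial μ) (n : ℕ) (z : Circle) :
    (monicOP μ n).eval (z : ℂ) ≠ 0 := fun h => by
  simpa [Circle.norm_coe] using norm_lt_one_of_isRoot_monicOP hμ h

end MonicOP

/-! ### Moments determined by an orthogonal polynomial -/

section MomentMatching

variable {μ ν : Measure Circle} [IsFiniteMeasure μ] [IsFiniteMeasure ν]

/-- Inverse Szegő recursion: orthogonality of `Φₙ₊₁` with respect to another measure is inherited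
by `Φₙ`. -/
theorem polyInner_X_pow_monicOP_of_succ (hμ : IsNontrivial μ) {n : ℕ}
    (h : ∀ k < n + 1, polyInner ν (X ^ k) (monicOP μ (n + 1)) = 0) :
    ∀ k < n, polyInner ν (X ^ k) (monicOP μ n) = 0 := by
  intro k hk
  set a := verblunsky μ n
  have hrec := monicOP_succ hμ n
  have hrev : revConj (n + 1) (monicOP μ (n + 1)) =
      revConj n (monicOP μ n) - C a * (X * monicOP μ n) := by
    rw [hrec, revConj_sub, revConj_C_mul, revConj_succ_X_mul (by simp),
      revConj_succ_revConj _ _ (by simp), Complex.conj_conj]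
  -- The recursions for Φₙ₊₁ and Φₙ₊₁*, solved for z Φₙ; the factor 1 - |a|² is nonzero.
  have hX : C (1 - a * conj a) * (X * monicOP μ n) =
      monicOP μ (n + 1) + C (conj a) * revConj (n + 1) (monicOP μ (n + 1)) := by
    rw [hrev, hrec, C_sub, C_1, C_mul]
    ring
  have hz : polyInner ν (X ^ (k + 1)) (C (1 - a * conj a) * (X * monicOP μ n)) = 0 := by
    rw [hX, polyInner_add_right, polyInner_C_mul_right, h _ (by omega),
      polyInner_X_pow_revConj (by omega) (by simp), h _ (by omega)]
    simp
  rw [polyInner_C_mul_right, polyInner_X_pow_add] at hz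
  refine (mul_eq_zero.1 hz).resolve_left fun h0 => ?_
  have h1 : ‖a‖ < 1 := norm_verblunsky_lt_one hμ n
  rw [Complex.mul_conj, Complex.normSq_eq_norm_sq] at h0
  have h0' : 1 - ‖a‖ ^ 2 = 0 := by exact_mod_cast h0
  nlinarith [norm_nonneg a]

/-- If `Φₙ` is orthogonal to lower degrees for another measure of the same mass, then the moments
of the two measures agree up to order `n`. -/
theorem polyInner_one_X_pow_eq (hμ : IsNontrivial μ) (h1 : polyInner ν 1 1 = polyInner μ 1 1)
    {n : ℕ} (h : ∀ k < n, polyInner ν (X ^ k) (monicOP μ n) = 0) :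
    ∀ k ≤ n, polyInner ν 1 (X ^ k) = polyInner μ 1 (X ^ k) := by
  induction n with
  | zero =>
    intro k hk
    obtain rfl : k = 0 := by omega
    simpa using h1
  | succ n ih =>
    have ih' := ih (polyInner_X_pow_monicOP_of_succ hμ h)
    intro k hk
    rcases Nat.lt_or_ge k (n + 1) with hk' | hk'
    · exact ih' k (by omega)
    obtain rfl : k = n + 1 := by omega
    -- Orthogonality of the monic Φₙ₊₁ to 1 expresses the moment of order n + 1 through lower ones,
    -- with the same coefficients for both measures.
    have e1 := h 0 (by omega)
    have e2 := polyInner_X_pow_monicOP hμ (n := n + 1) (k := 0) (by omega)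
    rw [pow_zero] at e1 e2
    have hc : (monicOP μ (n + 1)).coeff (n + 1) = 1 := by
      simpa [Monic, leadingCoeff] using monic_monicOP (μ := μ) (n + 1)
    rw [(monicOP μ (n + 1)).as_sum_range_C_mul_X_pow, natDegree_monicOP, Finset.sum_range_succ,
      hc, C_1, one_mul, polyInner_add_right, polyInner_sum_right] at e1 e2
    have e3 : ∑ i ∈ Finset.range (n + 1), polyInner ν 1 (C ((monicOP μ (n + 1)).coeff i) * X ^ i) =
        ∑ i ∈ Finset.range (n + 1),
          polyInner μ 1 (C ((monicOP μ (n + 1)).coeff i) * X ^ i) := by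
      refine Finset.sum_congr rfl fun i hi => ?_
      rw [polyInner_C_mul_right, polyInner_C_mul_right, ih' i (by simpa [Nat.lt_succ_iff] using hi)]
    rw [e3] at e1
    linear_combination e1 - e2

end MomentMatching

/-! ### Mean values and the weighted integral of log |p|² -/

section CircleMeasure

instance : IsProbabilityMeasure angleMeasure := by
  refine ⟨?_⟩
  rw [angleMeasure, Measure.smul_apply, Measure.restrict_apply_univ, Real.volume_Ioc, sub_zero,
    smul_eq_mul, ← ENNReal.ofReal_mul (by positivity), inv_mul_cancel₀ (by positivity),
    ENNReal.ofReal_one]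

theorem measurable_circleExp : Measurable (fun θ : ℝ => Circle.exp θ) :=
  Circle.exp.continuous.measurable

instance : IsProbabilityMeasure circleMeasure :=
  Measure.isProbabilityMeasure_map measurable_circleExp.aemeasurable

theorem integral_circleMeasure_eq_circleAverage {F : ℂ → ℂ}
    (hF : Continuous fun z : Circle => F z) :
    ∫ z : Circle, F z ∂circleMeasure = Real.circleAverage F 0 1 := by
  rw [circleMeasure, integral_map measurable_circleExp.aemeasurable
    hF.aestronglyMeasurable, angleMeasure, integral_smul_measure,
    ENNReal.toReal_ofReal (by positivity), Real.circleAverage_def,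
    intervalIntegral.integral_of_le (by positivity)]
  simp [circleMap]

/-- The mean value property on the unit disc. -/
theorem integral_circleMeasure_of_differentiableOn {F : ℂ → ℂ} {U : Set ℂ}
    (hball : Metric.closedBall (0 : ℂ) 1 ⊆ U) (hF : DifferentiableOn ℂ F U) :
    ∫ z : Circle, F z ∂circleMeasure = F 0 := by
  have hc : Continuous fun z : Circle => F z :=
    (hF.continuousOn.mono hball).comp_continuous continuous_subtype_val
      fun z => by simp [Circle.norm_coe]
  rw [integral_circleMeasure_eq_circleAverage hc]
  refine DiffContOnCl.circleAverage (DifferentiableOn.diffContOnCl ?_)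
  rw [abs_one, closure_ball _ one_ne_zero]
  exact hF.mono hball

/-- The weight `1 - cos θ` of the higher order Szegő theorem. -/
def cosWeight (z : Circle) : ℝ := 1 - (z : ℂ).re

theorem continuous_cosWeight : Continuous cosWeight :=
  continuous_const.sub (Complex.continuous_re.comp continuous_subtype_val)

theorem cosWeight_nonneg (z : Circle) : 0 ≤ cosWeight z := by
  have := Complex.re_le_norm (z : ℂ)
  rw [Circle.norm_coe] at this
  exact sub_nonneg.2 this

theorem cosWeight_le_two (z : Circle) : cosWeight z ≤ 2 := by
  have := (abs_le.1 (Complex.abs_re_le_norm (z : ℂ))).1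
  rw [Circle.norm_coe] at this
  unfold cosWeight
  linarith

theorem integral_cosWeight : ∫ z, cosWeight z ∂circleMeasure = 1 := by
  have h := integral_circleMeasure_of_differentiableOn (F := fun z => 1 - z)
    (Set.subset_univ _) (by fun_prop)
  have h2 := congrArg Complex.re h
  rw [← Complex.reCLM_apply, ← ContinuousLinearMap.integral_comp_comm _
    (integrable_of_continuous (by fun_prop))] at h2
  simpa [cosWeight] using h2

theorem norm_coe_sub_eq (z : Circle) (a : ℂ) : ‖(z : ℂ) - a‖ = ‖1 - conj a * z‖ := by
  have hz : (z : ℂ) * conj (z : ℂ) = 1 := by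
    rw [Complex.mul_conj, Circle.normSq_coe, Complex.ofReal_one]
  have : 1 - conj a * z = z * conj ((z : ℂ) - a) := by
    rw [map_sub]
    linear_combination -hz
  rw [this, norm_mul, Circle.norm_coe, one_mul, RCLike.norm_conj]

/-- On the circle |z - a| = |1 - conj a z|, and L(z) = log(1 - conj a z) is analytic near the closed
disc. There the integrand is the real part of 2L - zL - conj z L, and conj z L = L(z)/z extends
analytically across 0 because L(0) = 0. The mean value at 0 is -L'(0) = conj a. -/
theorem integral_cosWeight_mul_log_norm_sub {a : ℂ} (ha : ‖a‖ < 1) :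
    ∫ z : Circle, cosWeight z * Real.log (‖(z : ℂ) - a‖ ^ 2) ∂circleMeasure = a.re := by
  set L : ℂ → ℂ := fun z => Complex.log (1 - conj a * z) with hL
  set U : Set ℂ := {z | 0 < (1 - conj a * z).re} with hU
  have hUo : IsOpen U := isOpen_lt continuous_const (by fun_prop)
  have hball : Metric.closedBall (0 : ℂ) 1 ⊆ U := by
    intro z hz
    have h1 : ‖conj a * z‖ < 1 := by
      rw [norm_mul, RCLike.norm_conj]
      rw [mem_closedBall_zero_iff] at hz
      nlinarith [norm_nonneg a, norm_nonneg z]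
    have := Complex.re_le_norm (conj a * z)
    simp only [hU, Set.mem_ofPred_eq, Complex.sub_re, Complex.one_re]
    linarith
  have hLd : DifferentiableOn ℂ L U := by
    intro z hz
    have h1 : DifferentiableAt ℂ (fun z => 1 - conj a * z) z := by fun_prop
    exact (h1.clog (Or.inl hz)).differentiableWithinAt
  have h0 : (0 : ℂ) ∈ U := hball (by simp)
  have hMd : DifferentiableOn ℂ (dslope L 0) U :=
    (Complex.differentiableOn_dslope (hUo.mem_nhds h0)).2 hLd
  have hM0 : dslope L 0 0 = -conj a := by
    rw [dslope_same]
    have h1 : HasDerivAt (fun z : ℂ => 1 - conj a * z) (-conj a) 0 := by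
      simpa using ((hasDerivAt_id (0 : ℂ)).const_mul (conj a)).const_sub 1
    have := (h1.clog (by simp)).deriv
    simpa using this
  have hL0 : L 0 = 0 := by simp [hL]
  have hGd : DifferentiableOn ℂ (fun z => 2 * L z - z * L z - dslope L 0 z) U :=
    ((hLd.const_mul 2).sub (differentiableOn_id.mul hLd)).sub hMd
  have hG := integral_circleMeasure_of_differentiableOn hball hGd
  have hGc : Continuous fun z : Circle => 2 * L z - z * L z - dslope L 0 z :=
    (hGd.continuousOn.mono hball).comp_continuous continuous_subtype_val
      fun z => by simp [Circle.norm_coe]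
  have h2 := congrArg Complex.re hG
  rw [← Complex.reCLM_apply, ← ContinuousLinearMap.integral_comp_comm _
    (integrable_of_continuous hGc)] at h2
  simp only [hL0, hM0, Complex.reCLM_apply, mul_zero, sub_zero, zero_sub, neg_neg,
    Complex.conj_re] at h2
  rw [← h2]
  congr 1
  funext z
  have hz : conj (z : ℂ) * (z : ℂ) = 1 := by
    rw [mul_comm, Complex.mul_conj, Circle.normSq_coe, Complex.ofReal_one]
  have hM : dslope L 0 (z : ℂ) = conj (z : ℂ) * L z := by
    rw [dslope_of_ne _ z.coe_ne_zero, slope_def_field, hL0, sub_zero, sub_zero,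
      div_eq_iff z.coe_ne_zero]
    linear_combination (-L z) * hz
  rw [hM, norm_coe_sub_eq, Real.log_pow, cosWeight]
  have : Real.log ‖1 - conj a * (z : ℂ)‖ = (L z).re := (Complex.log_re _).symm
  rw [this]
  simp only [Complex.sub_re, Complex.mul_re, Complex.conj_re, Complex.conj_im, Complex.re_ofNat,
    Complex.im_ofNat]
  push_cast
  ring

theorem continuous_log_norm_eval_sq {p : ℂ[X]} (hp : ∀ z : Circle, p.eval (z : ℂ) ≠ 0) :
    Continuous fun z : Circle => Real.log (‖p.eval (z : ℂ)‖ ^ 2) :=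
  ((continuous_eval_circle p).norm.pow 2).log fun z => pow_ne_zero _ (norm_ne_zero_iff.2 (hp z))

theorem integral_cosWeight_mul_log_norm_prod (s : Multiset ℂ) (hs : ∀ a ∈ s, ‖a‖ < 1) :
    ∫ z : Circle, cosWeight z * Real.log (‖((s.map fun a => X - C a).prod).eval (z : ℂ)‖ ^ 2)
      ∂circleMeasure = s.sum.re := by
  induction s using Multiset.induction_on with
  | empty => simp
  | cons a s ih =>
    have ha := hs a (Multiset.mem_cons_self a s)
    have hs' : ∀ b ∈ s, ‖b‖ < 1 := fun b hb => hs b (Multiset.mem_cons_of_mem hb)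
    have hne1 : ∀ z : Circle, (X - C a).eval (z : ℂ) ≠ 0 := fun z h => by
      rw [eval_sub, eval_X, eval_C, sub_eq_zero] at h
      rw [← h, Circle.norm_coe] at ha
      exact lt_irrefl _ ha
    have hne2 : ∀ z : Circle, ((s.map fun a => X - C a).prod).eval (z : ℂ) ≠ 0 := fun z h => by
      rw [eval_multiset_prod, Multiset.prod_eq_zero_iff, Multiset.map_map] at h
      obtain ⟨b, hb, h⟩ := Multiset.mem_map.1 h
      simp only [Function.comp, eval_sub, eval_X, eval_C, sub_eq_zero] at h
      have := hs' b hb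
      rw [← h, Circle.norm_coe] at this
      exact lt_irrefl _ this
    rw [Multiset.sum_cons, Complex.add_re, ← ih hs', ← integral_cosWeight_mul_log_norm_sub ha,
      ← integral_add]
    · congr 1
      funext z
      rw [Multiset.map_cons, Multiset.prod_cons, eval_mul, norm_mul, mul_pow, Real.log_mul,
        mul_add, eval_sub, eval_X, eval_C]
      · exact pow_ne_zero _ (norm_ne_zero_iff.2 (hne1 z))
      · exact pow_ne_zero _ (norm_ne_zero_iff.2 (hne2 z))
    · have := continuous_log_norm_eval_sq hne1
      simp only [eval_sub, eval_X, eval_C] at this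
      exact integrable_of_continuous (continuous_cosWeight.mul this)
    · exact integrable_of_continuous (continuous_cosWeight.mul (continuous_log_norm_eval_sq hne2))

theorem integral_cosWeight_mul_log_norm_eval {p : ℂ[X]} (hp : p.Monic)
    (hroot : ∀ a, p.IsRoot a → ‖a‖ < 1) :
    ∫ z : Circle, cosWeight z * Real.log (‖p.eval (z : ℂ)‖ ^ 2) ∂circleMeasure =
      -p.nextCoeff.re := by
  have hprod : (p.roots.map fun a => X - C a).prod = p :=
    ((IsAlgClosed.splits p).eq_prod_roots_of_monic hp).symm
  have h := integral_cosWeight_mul_log_norm_prod p.roots fun a ha => hroot a (isRoot_of_mem_roots ha)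
  rw [hprod] at h
  rw [h]
  have h2 := multiset_prod_X_sub_C_nextCoeff p.roots
  rw [hprod] at h2
  rw [h2, Complex.neg_re, neg_neg]

end CircleMeasure

/-! ### Bernstein-Szegő measures -/

section BernsteinSzego

variable {μ : Measure Circle}

theorem integral_withDensity_of_continuous {r : Circle → ℝ} (hr : Continuous r)
    (hr0 : ∀ z, 0 ≤ r z) {E : Type*} [NormedAddCommGroup E] [NormedSpace ℝ E] (f : Circle → E) :
    ∫ z, f z ∂(circleMeasure.withDensity fun z => ENNReal.ofReal (r z)) =
      ∫ z, r z • f z ∂circleMeasure := by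
  rw [integral_withDensity_eq_integral_toReal_smul hr.measurable.ennreal_ofReal (by simp)]
  simp only [ENNReal.toReal_ofReal (hr0 _)]

/-- The Bernstein-Szegő approximation of degree `n` of `μ`: the probability measure with density
proportional to `|Φₙ|⁻²`. -/
def bernsteinSzego (μ : Measure Circle) (n : ℕ) : Measure Circle :=
  circleMeasure.withDensity fun z =>
    ENNReal.ofReal ((∫ z : Circle, (‖(monicOP μ n).eval (z : ℂ)‖ ^ 2)⁻¹ ∂circleMeasure)⁻¹ *
      (‖(monicOP μ n).eval (z : ℂ)‖ ^ 2)⁻¹)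

variable [IsFiniteMeasure μ]

theorem continuous_inv_norm_monicOP_sq (hμ : IsNontrivial μ) (n : ℕ) :
    Continuous fun z : Circle => (‖(monicOP μ n).eval (z : ℂ)‖ ^ 2)⁻¹ :=
  ((continuous_eval_circle _).norm.pow 2).inv₀ fun z =>
    pow_ne_zero _ (norm_ne_zero_iff.2 (eval_monicOP_circle_ne_zero hμ n z))

theorem integral_inv_norm_monicOP_sq_pos (hμ : IsNontrivial μ) (n : ℕ) :
    0 < ∫ z : Circle, (‖(monicOP μ n).eval (z : ℂ)‖ ^ 2)⁻¹ ∂circleMeasure := by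
  rw [integral_pos_iff_support_of_nonneg (fun _ => by positivity)
    (integrable_of_continuous (continuous_inv_norm_monicOP_sq hμ n))]
  have : (Function.support fun z : Circle => (‖(monicOP μ n).eval (z : ℂ)‖ ^ 2)⁻¹) = Set.univ := by
    ext z
    simp [eval_monicOP_circle_ne_zero hμ n z]
  rw [this]
  simp

theorem integral_bernsteinSzego_eq (hμ : IsNontrivial μ) (n : ℕ) {E : Type*}
    [NormedAddCommGroup E] [NormedSpace ℝ E] (f : Circle → E) :
    ∫ z, f z ∂(bernsteinSzego μ n) =
      ∫ z : Circle, ((∫ z : Circle, (‖(monicOP μ n).eval (z : ℂ)‖ ^ 2)⁻¹ ∂circleMeasure)⁻¹ *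
      (‖(monicOP μ n).eval (z : ℂ)‖ ^ 2)⁻¹) • f z ∂circleMeasure :=
  integral_withDensity_of_continuous
    (continuous_const.mul (continuous_inv_norm_monicOP_sq hμ n))
    (fun _ => mul_nonneg (inv_nonneg.2 (integral_inv_norm_monicOP_sq_pos hμ n).le)
      (by positivity)) f

theorem isProbabilityMeasure_bernsteinSzego (hμ : IsNontrivial μ) (n : ℕ) :
    IsProbabilityMeasure (bernsteinSzego μ n) := by
  refine ⟨?_⟩
  have hI := integral_inv_norm_monicOP_sq_pos hμ n
  rw [bernsteinSzego, withDensity_apply _ MeasurableSet.univ, Measure.restrict_univ,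
    ← ofReal_integral_eq_lintegral_ofReal, integral_const_mul, inv_mul_cancel₀ hI.ne',
    ENNReal.ofReal_one]
  · exact (integrable_of_continuous (continuous_inv_norm_monicOP_sq hμ n)).const_mul _
  · exact Filter.Eventually.of_forall fun _ => mul_nonneg (inv_nonneg.2 hI.le) (by positivity)

/-- On the circle conj(zᵏ) Φₙ / |Φₙ|² = zⁿ⁻ᵏ / Φₙ*. Since Φₙ* has no zeros in the closed disc, the
mean value is the value at 0, which vanishes for k < n. -/
theorem polyInner_bernsteinSzego_X_pow_monicOP (hμ : IsNontrivial μ) {n k : ℕ} (hk : k < n) :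
    polyInner (bernsteinSzego μ n) (X ^ k) (monicOP μ n) = 0 := by
  set U : Set ℂ := {z | (revConj n (monicOP μ n)).eval z ≠ 0}
  have hball : Metric.closedBall (0 : ℂ) 1 ⊆ U := fun z hz =>
    eval_revConj_monicOP_ne_zero hμ n (by simpa using hz)
  have hd : DifferentiableOn ℂ (fun z => z ^ (n - k) / (revConj n (monicOP μ n)).eval z) U :=
    DifferentiableOn.div (by fun_prop) (Polynomial.differentiable _).differentiableOn fun z hz => hz
  have h := integral_circleMeasure_of_differentiableOn hball hd
  rw [zero_pow (by omega), zero_div] at h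
  rw [polyInner, integral_bernsteinSzego_eq hμ]
  simp only [mul_smul, integral_smul]
  refine smul_eq_zero_of_right _ ?_
  rw [← h]
  congr 1
  funext z
  have hz : (z : ℂ) ≠ 0 := z.coe_ne_zero
  have hne := eval_monicOP_circle_ne_zero hμ n z
  have hne' : conj ((monicOP μ n).eval (z : ℂ)) ≠ 0 := by simpa using hne
  rw [eval_revConj_circle (by simp), eval_pow, eval_X, ← Complex.normSq_eq_norm_sq,
    Complex.real_smul, Complex.ofReal_inv, ← Complex.mul_conj, map_pow, ← Circle.coe_inv_eq_conj,
    Circle.coe_inv, pow_sub₀ _ hz hk.le, inv_pow]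
  field_simp

/-- Orthogonality reduces ‖p‖² to the pairing of zⁿ with p. This writes the squared norm linearly in
moments of order at most n, so it agrees for measures sharing these moments. -/
theorem sqNorm_eq_conj_polyInner_revConj {ν : Measure Circle} [IsFiniteMeasure ν] {n : ℕ}
    {p : ℂ[X]} (hp : p.Monic) (hn : p.natDegree = n)
    (h : ∀ k < n, polyInner ν (X ^ k) p = 0) :
    (sqNorm ν p : ℂ) = conj (polyInner ν 1 (revConj n p)) := by
  have h0 := polyInner_X_pow_revConj (μ := ν) (Nat.zero_le n) hn.le
  rw [pow_zero, Nat.sub_zero] at h0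
  rw [h0, Complex.conj_conj, ← polyInner_self, ← sub_eq_zero]
  have hlow : (p - X ^ n).degree < (n : WithBot ℕ) := by
    have hdp : p.degree = (n : WithBot ℕ) := by rw [degree_eq_natDegree hp.ne_zero, hn]
    rw [← hdp]
    refine degree_sub_lt_left (by rw [hdp, degree_X_pow]) hp.ne_zero ?_
    rw [hp.leadingCoeff, (monic_X_pow n).leadingCoeff]
  have := polyInner_eq_zero_of_degree_lt h hlow
  have h2 : polyInner ν p p = polyInner ν (p - X ^ n) p + polyInner ν (X ^ n) p := by
    rw [← polyInner_add_left, sub_add_cancel]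
  rw [h2, this, zero_add, sub_self]

end BernsteinSzego

/-! ### Weak convergence from convergence of moments -/

section WeakConvergence

open Filter Topology

theorem exists_span_fourier_norm_sub_le (F : C(Circle, ℂ)) {ε : ℝ} (hε : 0 < ε) :
    ∃ P ∈ Submodule.span ℂ (Set.range (fourier (T := (1 : ℝ)))),
      ∀ z : Circle, ‖F z - P ((AddCircle.homeomorphCircle one_ne_zero).symm z)‖ ≤ ε := by
  set e : AddCircle (1 : ℝ) ≃ₜ Circle := AddCircle.homeomorphCircle one_ne_zero
  have hmem : F.comp (e : C(AddCircle (1 : ℝ), Circle)) ∈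
      (Submodule.span ℂ (Set.range (fourier (T := (1 : ℝ))))).topologicalClosure := by
    rw [span_fourier_closure_eq_top]
    trivial
  obtain ⟨P, hP, hd⟩ := Metric.mem_closure_iff.1 hmem ε hε
  refine ⟨P, hP, fun z => ?_⟩
  have := (ContinuousMap.norm_coe_le_norm (F.comp (e : C(AddCircle (1 : ℝ), Circle)) - P) (e.symm z))
  rw [← dist_eq_norm] at this
  simpa using this.trans hd.le

/-- Probability measures on the circle whose moments are eventually equal to those of `μ` converge
weakly to `μ`. -/
theorem tendsto_integral_of_moments {μ : Measure Circle} [IsProbabilityMeasure μ]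
    {ν : ℕ → Measure Circle} (hν : ∀ n, IsProbabilityMeasure (ν n))
    (h : ∀ k : ℕ, ∀ n ≥ k, polyInner (ν n) 1 (X ^ k) = polyInner μ 1 (X ^ k))
    (F : C(Circle, ℂ)) : Tendsto (fun n => ∫ z, F z ∂ν n) atTop (𝓝 (∫ z, F z ∂μ)) := by
  set e : AddCircle (1 : ℝ) ≃ₜ Circle := AddCircle.homeomorphCircle one_ne_zero with he
  have hcont : ∀ P : C(AddCircle (1 : ℝ), ℂ), Continuous fun z => P (e.symm z) := fun P =>
    P.continuous.comp e.symm.continuous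
  have hspan : ∀ P ∈ Submodule.span ℂ (Set.range (fourier (T := (1 : ℝ)))),
      ∀ᶠ n in atTop, ∫ z, P (e.symm z) ∂ν n = ∫ z, P (e.symm z) ∂μ := by
    intro P hP
    induction hP using Submodule.span_induction with
    | mem P hP =>
      obtain ⟨j, rfl⟩ := hP
      have hpow : ∀ z : Circle, AddCircle.toCircle (j • (e.symm z)) = z ^ j := fun z => by
        rw [AddCircle.toCircle_zsmul, ← AddCircle.homeomorphCircle_apply one_ne_zero, ← he,
          Homeomorph.apply_symm_apply]
      simp only [fourier_apply, hpow]
      obtain ⟨m, hj⟩ := Int.eq_nat_or_neg j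
      filter_upwards [eventually_ge_atTop m] with n hn
      have hm := h m n hn
      simp only [polyInner, eval_one, map_one, one_mul, eval_pow, eval_X] at hm
      rcases hj with rfl | rfl
      · simpa using hm
      -- Moments of negative order are conjugates of those of positive order.
      · have hm' := congrArg conj hm
        rw [← integral_conj, ← integral_conj] at hm'
        simpa [← Circle.coe_inv_eq_conj] using hm'
    | zero => simp
    | add P Q _ _ ihP ihQ =>
      filter_upwards [ihP, ihQ] with n hP hQ
      simp only [ContinuousMap.add_apply]
      rw [integral_add (integrable_of_continuous (hcont P)) (integrable_of_continuous (hcont Q)),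
        integral_add (integrable_of_continuous (hcont P)) (integrable_of_continuous (hcont Q)),
        hP, hQ]
    | smul c P _ ihP =>
      filter_upwards [ihP] with n hP
      simp only [ContinuousMap.smul_apply]
      rw [integral_smul, integral_smul, hP]
  have hdist : ∀ (ρ : Measure Circle) [IsProbabilityMeasure ρ] (P : C(AddCircle (1 : ℝ), ℂ))
      (δ : ℝ), (∀ z, ‖F z - P (e.symm z)‖ ≤ δ) →
      ‖∫ z, F z ∂ρ - ∫ z, P (e.symm z) ∂ρ‖ ≤ δ := by
    intro ρ _ P δ hδ
    rw [← integral_sub (integrable_of_continuous F.continuous) (integrable_of_continuous (hcont P))]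
    simpa using norm_integral_le_of_norm_le_const (μ := ρ) (Eventually.of_forall hδ)
  rw [Metric.tendsto_atTop']
  intro ε hε
  obtain ⟨P, hP, hd⟩ := exists_span_fourier_norm_sub_le F (by positivity : 0 < ε / 3)
  obtain ⟨N, hN⟩ := eventually_atTop.1 (hspan P hP)
  refine ⟨N, fun n hn => ?_⟩
  have h1 := hdist μ P _ hd
  have h2 := @hdist (ν n) (hν n) P _ hd
  rw [hN n hn.le] at h2
  rw [dist_eq_norm]
  calc ‖∫ z, F z ∂ν n - ∫ z, F z ∂μ‖
      = ‖(∫ z, F z ∂ν n - ∫ z, P (e.symm z) ∂μ) - (∫ z, F z ∂μ - ∫ z, P (e.symm z) ∂μ)‖ := by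
        congr 1; ring
    _ ≤ ε / 3 + ε / 3 := (norm_sub_le _ _).trans (add_le_add h2 h1)
    _ < ε := by linarith

end WeakConvergence

/-! ### Variational inequality for the Bernstein-Szegő measures and its limit -/

section Variational

open Filter Topology

variable {μ : Measure Circle} [IsProbabilityMeasure μ]

theorem polyInner_one_one (ν : Measure Circle) [IsProbabilityMeasure ν] : polyInner ν 1 1 = 1 := by
  simp [polyInner]

/-- The moments of `μ` up to order `n` are those of its Bernstein-Szegő approximation. -/
theorem polyInner_bernsteinSzego_one_X_pow (hμ : IsNontrivial μ) {n k : ℕ} (hk : k ≤ n) :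
    polyInner (bernsteinSzego μ n) 1 (X ^ k) = polyInner μ 1 (X ^ k) := by
  have := isProbabilityMeasure_bernsteinSzego hμ n
  refine polyInner_one_X_pow_eq hμ ?_ (fun k hk => ?_) k hk
  · rw [polyInner_one_one, polyInner_one_one]
  · exact polyInner_bernsteinSzego_X_pow_monicOP hμ hk

/-- The normalizing constant is the squared norm of Φₙ in its own Bernstein-Szegő measure, where the
integrand is constant. That norm depends only on moments up to order n, so it equals the one for μ.
-/
theorem inv_integral_inv_norm_monicOP_sq (hμ : IsNontrivial μ) (n : ℕ) :
    (∫ z : Circle, (‖(monicOP μ n).eval (z : ℂ)‖ ^ 2)⁻¹ ∂circleMeasure)⁻¹ =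
      sqNorm μ (monicOP μ n) := by
  have := isProbabilityMeasure_bernsteinSzego hμ n
  have h1 : sqNorm (bernsteinSzego μ n) (monicOP μ n) =
      (∫ z : Circle, (‖(monicOP μ n).eval (z : ℂ)‖ ^ 2)⁻¹ ∂circleMeasure)⁻¹ := by
    rw [sqNorm, integral_bernsteinSzego_eq hμ]
    have : ∀ z : Circle, (‖(monicOP μ n).eval (z : ℂ)‖ ^ 2) ≠ 0 := fun z =>
      pow_ne_zero _ (norm_ne_zero_iff.2 (eval_monicOP_circle_ne_zero hμ n z))
    simp only [smul_eq_mul, mul_assoc, inv_mul_cancel₀ (this _), mul_one]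
    simp
  rw [← h1]
  have h2 := sqNorm_eq_conj_polyInner_revConj (ν := bernsteinSzego μ n) (monic_monicOP n)
    (natDegree_monicOP n) fun k hk => polyInner_bernsteinSzego_X_pow_monicOP hμ hk
  have h3 := sqNorm_eq_conj_polyInner_revConj (ν := μ) (monic_monicOP n)
    (natDegree_monicOP n) fun k hk => polyInner_X_pow_monicOP hμ hk
  have hp : (revConj n (monicOP μ n)).natDegree < n + 1 :=
    Nat.lt_succ_of_le (natDegree_revConj_le (by simp))
  have h4 : polyInner (bernsteinSzego μ n) 1 (revConj n (monicOP μ n)) =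
      polyInner μ 1 (revConj n (monicOP μ n)) := by
    rw [(revConj n (monicOP μ n)).as_sum_range_C_mul_X_pow' hp, polyInner_sum_right,
      polyInner_sum_right]
    refine Finset.sum_congr rfl fun i hi => ?_
    rw [polyInner_C_mul_right, polyInner_C_mul_right, polyInner_bernsteinSzego_one_X_pow hμ
      (Nat.lt_succ_iff.1 (Finset.mem_range.1 hi))]
  rw [h4, ← h3] at h2
  exact_mod_cast h2

theorem integral_bernsteinSzego (hμ : IsNontrivial μ) (n : ℕ) (f : Circle → ℝ) :
    ∫ z, f z ∂(bernsteinSzego μ n) = ∫ z : Circle, sqNorm μ (monicOP μ n) *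
      (‖(monicOP μ n).eval (z : ℂ)‖ ^ 2)⁻¹ * f z ∂circleMeasure := by
  rw [integral_bernsteinSzego_eq hμ, inv_integral_inv_norm_monicOP_sq hμ]
  rfl

theorem tendsto_integral_bernsteinSzego (hμ : IsNontrivial μ) {f : Circle → ℝ}
    (hf : Continuous f) :
    Tendsto (fun n => ∫ z, f z ∂(bernsteinSzego μ n)) atTop (𝓝 (∫ z, f z ∂μ)) := by
  have h := tendsto_integral_of_moments (isProbabilityMeasure_bernsteinSzego hμ)
    (fun k n hkn => polyInner_bernsteinSzego_one_X_pow hμ hkn)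
    ⟨fun z => (f z : ℂ), Complex.continuous_ofReal.comp hf⟩
  simp only [ContinuousMap.coe_mk, integral_complex_ofReal] at h
  exact_mod_cast (Complex.continuous_re.tendsto _).comp h

/-- The value `∫ (1 - cos θ) log wₙ dθ/2π` for the density `wₙ = ‖Φₙ‖² |Φₙ|⁻²` of the `n`-th
Bernstein-Szegő approximation, see `integral_cosWeight_mul_log_bernsteinSzego`. -/
def finiteSzegoIntegral (μ : Measure Circle) (n : ℕ) : ℝ :=
  Real.log (sqNorm μ (monicOP μ n)) + (monicOP μ n).nextCoeff.re

theorem integral_cosWeight_mul_log_monicOP (hμ : IsNontrivial μ) (n : ℕ) :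
    ∫ z : Circle, cosWeight z * Real.log (‖(monicOP μ n).eval (z : ℂ)‖ ^ 2) ∂circleMeasure =
      Real.log (sqNorm μ (monicOP μ n)) - finiteSzegoIntegral μ n := by
  rw [integral_cosWeight_mul_log_norm_eval (monic_monicOP n) fun a ha =>
    norm_lt_one_of_isRoot_monicOP hμ ha, finiteSzegoIntegral]
  ring

/-- This is log x ≤ x - 1 at x = f wₙ, multiplied by the weight 1 - cos θ of total mass 1 and
integrated. -/
theorem integral_cosWeight_mul_log_add_le_bernsteinSzego (hμ : IsNontrivial μ) (n : ℕ)
    {f : Circle → ℝ} (hf : Continuous f) (hf0 : ∀ z, 0 < f z) :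
    ∫ z, cosWeight z * Real.log (f z) ∂circleMeasure + finiteSzegoIntegral μ n ≤
      ∫ z, cosWeight z * f z ∂(bernsteinSzego μ n) - 1 := by
  have hΦ : ∀ z : Circle, 0 < ‖(monicOP μ n).eval (z : ℂ)‖ ^ 2 := fun z =>
    pow_pos (norm_pos_iff.2 (eval_monicOP_circle_ne_zero hμ n z)) _
  have hc := sqNorm_pos hμ (monicOP_ne_zero (μ := μ) n)
  have hlogf : Continuous fun z => Real.log (f z) := hf.log fun z => (hf0 z).ne'
  have hlogΦ := continuous_log_norm_eval_sq (eval_monicOP_circle_ne_zero hμ n)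
  have hinv := continuous_inv_norm_monicOP_sq hμ n
  have hw := continuous_cosWeight
  have key : ∫ z : Circle, (cosWeight z * Real.log (f z) +
      cosWeight z * Real.log (sqNorm μ (monicOP μ n)) -
      cosWeight z * Real.log (‖(monicOP μ n).eval (z : ℂ)‖ ^ 2)) ∂circleMeasure ≤
      ∫ z : Circle, (sqNorm μ (monicOP μ n) * (‖(monicOP μ n).eval (z : ℂ)‖ ^ 2)⁻¹ *
        (cosWeight z * f z) - cosWeight z) ∂circleMeasure := by
    refine integral_mono (integrable_of_continuous (by fun_prop))
      (integrable_of_continuous (by fun_prop)) fun z => ?_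
    have hx : 0 < f z * sqNorm μ (monicOP μ n) * (‖(monicOP μ n).eval (z : ℂ)‖ ^ 2)⁻¹ :=
      mul_pos (mul_pos (hf0 z) hc) (inv_pos.2 (hΦ z))
    have hlog := Real.log_le_sub_one_of_pos hx
    rw [Real.log_mul (mul_pos (hf0 z) hc).ne' (inv_pos.2 (hΦ z)).ne',
      Real.log_mul (hf0 z).ne' hc.ne', Real.log_inv] at hlog
    have := mul_le_mul_of_nonneg_left hlog (cosWeight_nonneg z)
    dsimp only
    linarith
  rw [integral_sub (integrable_of_continuous (by fun_prop))
      (integrable_of_continuous (by fun_prop)),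
    integral_add (integrable_of_continuous (by fun_prop))
      (integrable_of_continuous (by fun_prop)), integral_mul_const, integral_cosWeight,
    integral_cosWeight_mul_log_monicOP hμ,
    integral_sub (integrable_of_continuous (by fun_prop))
      (integrable_of_continuous (by fun_prop)), integral_cosWeight,
    ← integral_bernsteinSzego hμ] at key
  linarith

theorem integral_cosWeight_mul_log_le_of_continuous (hμ : IsNontrivial μ) {M : ℝ}
    (hM : ∀ n, -M ≤ finiteSzegoIntegral μ n) {f : Circle → ℝ} (hf : Continuous f)
    (hf0 : ∀ z, 0 < f z) :
    ∫ z, cosWeight z * Real.log (f z) ∂circleMeasure ≤ ∫ z, cosWeight z * f z ∂μ + M - 1 := by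
  have h := tendsto_integral_bernsteinSzego hμ (f := fun z => cosWeight z * f z)
    (continuous_cosWeight.mul hf)
  have h2 := ge_of_tendsto' h (b := ∫ z, cosWeight z * Real.log (f z) ∂circleMeasure - M + 1)
    fun n => by linarith [hM n, integral_cosWeight_mul_log_add_le_bernsteinSzego hμ n hf hf0]
  linarith

theorem abs_log_sub_log_le {x y : ℝ} (hx : 1 ≤ x) (hy : 1 ≤ y) :
    |Real.log x - Real.log y| ≤ |x - y| := by
  have key : ∀ {a b : ℝ}, 1 ≤ a → 1 ≤ b → Real.log a - Real.log b ≤ |a - b| := by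
    intro a b ha hb
    have hb0 : 0 < b := by linarith
    rw [← Real.log_div (by linarith) hb0.ne']
    refine (Real.log_le_sub_one_of_pos (by positivity)).trans ?_
    rw [div_sub_one hb0.ne']
    refine (le_abs_self _).trans ?_
    rw [abs_div, abs_of_pos hb0]
    exact div_le_self (abs_nonneg _) hb
  refine abs_le'.2 ⟨key hx hy, ?_⟩
  rw [neg_sub, abs_sub_comm]
  exact key hy hx

/-- Approximation by continuous functions in L¹ of μ and Lebesgue measure at once controls both
sides, because log is 1-Lipschitz on [1, ∞) and the weight is at most 2. -/
theorem integral_cosWeight_mul_log_le_of_bounded (hμ : IsNontrivial μ) {M : ℝ}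
    (hM : ∀ n, -M ≤ finiteSzegoIntegral μ n) {g : Circle → ℝ} (hg : Measurable g) {K : ℝ}
    (hg1 : ∀ z, 1 ≤ g z) (hgK : ∀ z, g z ≤ K) :
    ∫ z, cosWeight z * Real.log (g z) ∂circleMeasure ≤ ∫ z, cosWeight z * g z ∂μ + M - 1 := by
  refine le_of_forall_pos_le_add fun ε hε => ?_
  have hgb : ∀ (ρ : Measure Circle) [IsFiniteMeasure ρ], Integrable g ρ := fun ρ _ =>
    Integrable.of_bound hg.aestronglyMeasurable K (Eventually.of_forall fun z => by
      rw [Real.norm_eq_abs, abs_of_nonneg (by linarith [hg1 z])]; exact hgK z)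
  obtain ⟨f₀, hf₀, -⟩ := (hgb (μ + circleMeasure)).exists_boundedContinuous_integral_sub_le
    (by positivity : 0 < ε / 4)
  -- As g ≥ 1, cutting f₀ off below at 1 does not increase the distance to g.
  set f : Circle → ℝ := fun z => max (f₀ z) 1 with hf
  have hfc : Continuous f := f₀.continuous.max continuous_const
  have hf1 : ∀ z, 1 ≤ f z := fun z => le_max_right _ _
  have hfg : ∀ z, |g z - f z| ≤ ‖g z - f₀ z‖ := fun z => by
    have := abs_max_sub_max_le_abs (g z) (f₀ z) 1
    rwa [max_eq_left (hg1 z)] at this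
  have hd : ∀ (ρ : Measure Circle) [IsFiniteMeasure ρ],
      Integrable (fun z => |g z - f z|) ρ := fun ρ _ =>
    ((hgb ρ).sub (integrable_of_continuous hfc)).abs
  have hsum : ∫ z, |g z - f z| ∂μ + ∫ z, |g z - f z| ∂circleMeasure ≤ ε / 4 := by
    rw [← integral_add_measure (hd μ) (hd circleMeasure)]
    refine le_trans (integral_mono (hd _) ?_ hfg) hf₀
    exact ((hgb _).sub (integrable_of_continuous f₀.continuous)).norm
  have hn1 : 0 ≤ ∫ z, |g z - f z| ∂μ := integral_nonneg fun _ => abs_nonneg _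
  have hn2 : 0 ≤ ∫ z, |g z - f z| ∂circleMeasure := integral_nonneg fun _ => abs_nonneg _
  have hc := integral_cosWeight_mul_log_le_of_continuous hμ hM hfc fun z =>
    zero_lt_one.trans_le (hf1 z)
  have hwm := continuous_cosWeight.measurable
  have hwb : ∀ z, ‖cosWeight z‖ ≤ 2 := fun z => by
    rw [Real.norm_eq_abs, abs_of_nonneg (cosWeight_nonneg z)]; exact cosWeight_le_two z
  have i1 : ∫ z, cosWeight z * f z ∂μ ≤ ∫ z, (cosWeight z * g z + 2 * |g z - f z|) ∂μ := by
    refine integral_mono (integrable_of_continuous (continuous_cosWeight.mul hfc))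
      (((hgb μ).bdd_mul hwm.aestronglyMeasurable (Eventually.of_forall hwb)).add
        ((hd μ).const_mul 2)) fun z => ?_
    have h1 := neg_abs_le (g z - f z)
    have := cosWeight_nonneg z
    have := cosWeight_le_two z
    dsimp only
    nlinarith [abs_nonneg (g z - f z), mul_nonneg (cosWeight_nonneg z)
      (by linarith : 0 ≤ g z - f z + |g z - f z|)]
  have hlogg : Integrable (fun z => Real.log (g z)) circleMeasure :=
    Integrable.of_bound hg.log.aestronglyMeasurable (Real.log K) (Eventually.of_forall fun z => by
      rw [Real.norm_eq_abs, abs_of_nonneg (Real.log_nonneg (hg1 z))]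
      exact Real.log_le_log (by linarith [hg1 z]) (hgK z))
  have i2 : ∫ z, cosWeight z * Real.log (g z) ∂circleMeasure ≤
      ∫ z, (cosWeight z * Real.log (f z) + 2 * |g z - f z|) ∂circleMeasure := by
    have hlogf : Continuous fun z => Real.log (f z) := hfc.log fun z => by linarith [hf1 z]
    refine integral_mono (hlogg.bdd_mul hwm.aestronglyMeasurable (Eventually.of_forall hwb))
      ((integrable_of_continuous (continuous_cosWeight.mul hlogf)).add
        ((hd _).const_mul 2)) fun z => ?_
    have h1 := (abs_le.1 (abs_log_sub_log_le (hg1 z) (hf1 z))).2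
    have := cosWeight_nonneg z
    have := cosWeight_le_two z
    dsimp only
    nlinarith [abs_nonneg (g z - f z), mul_nonneg (cosWeight_nonneg z)
      (by linarith : 0 ≤ |g z - f z| - (Real.log (g z) - Real.log (f z)))]
  rw [integral_add ((hgb μ).bdd_mul hwm.aestronglyMeasurable (Eventually.of_forall hwb))
    ((hd μ).const_mul 2), integral_const_mul] at i1
  have hwlog : Continuous fun z => cosWeight z * Real.log (f z) :=
    continuous_cosWeight.mul (hfc.log fun z => by linarith [hf1 z])
  rw [integral_add (integrable_of_continuous hwlog) ((hd _).const_mul 2), integral_const_mul] at i2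
  linarith

end Variational

/-! ### Lower bounds for Zₙ versus integrability of the negative part -/

section Density

open Filter Topology

variable {μ : Measure Circle}

/-- The negative part of the integrand `(1 - cos θ) log w`, as a function on the circle. -/
def negPartIntegrand (μ : Measure Circle) (z : Circle) : ℝ≥0∞ :=
  (-((cosWeight z : EReal) * ENNReal.log (μ.rnDeriv circleMeasure z))).toENNReal

theorem measurable_cosWeight_mul_log (μ : Measure Circle) :
    Measurable fun z => (cosWeight z : EReal) * ENNReal.log (μ.rnDeriv circleMeasure z) :=
  (measurable_coe_real_ereal.comp continuous_cosWeight.measurable).mul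
    (ENNReal.measurable_log.comp (Measure.measurable_rnDeriv μ circleMeasure))

theorem measurable_negPartIntegrand (μ : Measure Circle) : Measurable (negPartIntegrand μ) :=
  (measurable_cosWeight_mul_log μ).neg.ereal_toENNReal

theorem higherSzegoIntegral_eq (μ : Measure Circle) :
    higherSzegoIntegral μ =
      ((∫⁻ z, ((cosWeight z : EReal) *
        ENNReal.log (μ.rnDeriv circleMeasure z)).toENNReal ∂circleMeasure : ℝ≥0∞) : EReal) -
      ((∫⁻ z, negPartIntegrand μ z ∂circleMeasure : ℝ≥0∞) : EReal) := by
  have hm := measurable_cosWeight_mul_log μ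
  have hlin : ∀ {f : Circle → ℝ≥0∞}, Measurable f →
      ∫⁻ z, f z ∂circleMeasure = ∫⁻ θ, f (Circle.exp θ) ∂angleMeasure := fun hf => by
    conv_lhs => rw [circleMeasure]
    exact lintegral_map hf measurable_circleExp
  rw [hlin hm.ereal_toENNReal, hlin (measurable_negPartIntegrand μ)]
  simp only [higherSzegoIntegral, extIntegral, negPartIntegrand, cosWeight, weight, Circle.coe_exp,
    Complex.exp_ofReal_mul_I_re]

theorem cosWeight_mul_log_toENNReal_le (z : Circle) (w : ℝ≥0∞) :
    ((cosWeight z : EReal) * ENNReal.log w).toENNReal ≤ 2 * w := by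
  have h0 := cosWeight_nonneg z
  rcases eq_or_ne w ⊤ with rfl | htop
  · simp
  rcases eq_or_ne w 0 with rfl | hw
  · rw [EReal.toENNReal_of_nonpos]
    · exact zero_le
    · rw [ENNReal.log_zero]
      exact EReal.mul_nonpos_iff.2 (Or.inl ⟨by exact_mod_cast h0, bot_le⟩)
  · rw [ENNReal.log_pos_real hw htop, ← EReal.coe_mul, EReal.real_coe_toENNReal,
      ← ENNReal.ofReal_toReal htop, ENNReal.toReal_ofReal ENNReal.toReal_nonneg,
      ← ENNReal.ofReal_ofNat 2, ← ENNReal.ofReal_mul (by norm_num)]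
    refine ENNReal.ofReal_le_ofReal ?_
    have hpos := ENNReal.toReal_pos hw htop
    have h1 := Real.log_le_sub_one_of_pos hpos
    nlinarith [cosWeight_le_two z]

theorem bot_lt_higherSzegoIntegral_iff [IsFiniteMeasure μ] :
    ⊥ < higherSzegoIntegral μ ↔ ∫⁻ z, negPartIntegrand μ z ∂circleMeasure < ⊤ := by
  have hA : ∫⁻ z, ((cosWeight z : EReal) *
      ENNReal.log (μ.rnDeriv circleMeasure z)).toENNReal ∂circleMeasure < ⊤ := by
    refine (lintegral_mono fun z => cosWeight_mul_log_toENNReal_le z _).trans_lt ?_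
    rw [lintegral_const_mul _ (Measure.measurable_rnDeriv _ _)]
    exact ENNReal.mul_lt_top (by simp) (Measure.lintegral_rnDeriv_lt_top _ _)
  rw [higherSzegoIntegral_eq]
  generalize ∫⁻ z, ((cosWeight z : EReal) *
      ENNReal.log (μ.rnDeriv circleMeasure z)).toENNReal ∂circleMeasure = A at hA
  generalize ∫⁻ z, negPartIntegrand μ z ∂circleMeasure = B
  rcases eq_or_ne B ⊤ with rfl | hB
  · simp
  · lift A to NNReal using hA.ne
    lift B to NNReal using hB
    refine iff_of_true ?_ ENNReal.coe_lt_top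
    exact EReal.bot_lt_coe ((A : ℝ) - (B : ℝ))

theorem negPartIntegrand_of_pos {z : Circle} (h0 : μ.rnDeriv circleMeasure z ≠ 0)
    (htop : μ.rnDeriv circleMeasure z ≠ ⊤) :
    negPartIntegrand μ z =
      ENNReal.ofReal (-(cosWeight z * Real.log (μ.rnDeriv circleMeasure z).toReal)) := by
  rw [negPartIntegrand, ENNReal.log_pos_real h0 htop, ← EReal.coe_mul, ← EReal.coe_neg,
    EReal.real_coe_toENNReal]

theorem negPartIntegrand_of_cosWeight_eq_zero {z : Circle} (h : cosWeight z = 0) :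
    negPartIntegrand μ z = 0 := by
  simp [negPartIntegrand, h]

theorem negPartIntegrand_of_eq_zero {z : Circle} (h0 : μ.rnDeriv circleMeasure z = 0)
    (h : cosWeight z ≠ 0) : negPartIntegrand μ z = ⊤ := by
  have hpos : 0 < cosWeight z := lt_of_le_of_ne (cosWeight_nonneg z) h.symm
  rw [negPartIntegrand, h0, ENNReal.log_zero, EReal.coe_mul_bot_of_pos hpos, EReal.neg_bot,
    EReal.toENNReal_top]

/-- The truncated density decreases to min(w, 1) ≤ w. Where w = 0 it is 1/(k + 1), and its
reciprocal has logarithm tending to ∞. -/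
theorem negPartIntegrand_le_liminf {z : Circle} (htop : μ.rnDeriv circleMeasure z ≠ ⊤) :
    negPartIntegrand μ z ≤ liminf (fun k : ℕ => ENNReal.ofReal (cosWeight z * Real.log
      (max (1 / ((k : ℝ) + 1)) (min (μ.rnDeriv circleMeasure z).toReal 1))⁻¹)) atTop := by
  by_cases hc : cosWeight z = 0
  · rw [negPartIntegrand_of_cosWeight_eq_zero hc]
    exact zero_le
  have hcpos : 0 < cosWeight z := lt_of_le_of_ne (cosWeight_nonneg z) (Ne.symm hc)
  have hd : Tendsto (fun k : ℕ => 1 / ((k : ℝ) + 1)) atTop (𝓝 0) :=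
    tendsto_one_div_add_atTop_nhds_zero_nat
  by_cases h0 : μ.rnDeriv circleMeasure z = 0
  · have ht : Tendsto (fun k : ℕ => ENNReal.ofReal (cosWeight z * Real.log
      (max (1 / ((k : ℝ) + 1)) (min (μ.rnDeriv circleMeasure z).toReal 1))⁻¹)) atTop (𝓝 ⊤) := by
      refine ENNReal.tendsto_ofReal_atTop.comp (Tendsto.const_mul_atTop hcpos
        (Real.tendsto_log_atTop.comp ?_))
      refine Tendsto.congr (fun k => ?_)
        (tendsto_atTop_add_const_right atTop (1 : ℝ) tendsto_natCast_atTop_atTop)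
      rw [h0, ENNReal.toReal_zero, min_eq_left zero_le_one, max_eq_left (by positivity), one_div,
        inv_inv]
    rw [ht.liminf_eq]
    exact le_top
  · have hWpos : 0 < (μ.rnDeriv circleMeasure z).toReal := ENNReal.toReal_pos h0 htop
    set W := (μ.rnDeriv circleMeasure z).toReal
    have hm : 0 < min W 1 := lt_min hWpos one_pos
    have ht : Tendsto (fun k : ℕ => ENNReal.ofReal (cosWeight z * Real.log
        (max (1 / ((k : ℝ) + 1)) (min W 1))⁻¹)) atTop
        (𝓝 (ENNReal.ofReal (cosWeight z * Real.log (min W 1)⁻¹))) := by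
      refine ENNReal.tendsto_ofReal (Tendsto.const_mul _
        (Tendsto.log (Tendsto.inv₀ ?_ hm.ne') (inv_pos.2 hm).ne'))
      have := hd.max (tendsto_const_nhds (x := min W 1))
      rwa [max_eq_right hm.le] at this
    rw [ht.liminf_eq, negPartIntegrand_of_pos h0 htop]
    refine ENNReal.ofReal_le_ofReal ?_
    rw [Real.log_inv, mul_neg]
    exact neg_le_neg (mul_le_mul_of_nonneg_left (Real.log_le_log hm (min_le_left _ _)) hcpos.le)

variable [IsProbabilityMeasure μ]

theorem norm_cosWeight_le_two (z : Circle) : ‖cosWeight z‖ ≤ 2 := by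
  rw [Real.norm_eq_abs, abs_of_nonneg (cosWeight_nonneg z)]
  exact cosWeight_le_two z

theorem integrable_rnDeriv_mul_of_continuous {f : Circle → ℝ} (hf : Continuous f) :
    Integrable (fun z => (μ.rnDeriv circleMeasure z).toReal * f z) circleMeasure := by
  obtain ⟨K, hK⟩ := (isCompact_range hf).isBounded.exists_norm_le
  exact Measure.integrable_toReal_rnDeriv.mul_bdd hf.aestronglyMeasurable
    (Eventually.of_forall fun z => hK _ ⟨z, rfl⟩)

theorem integral_withDensity_rnDeriv (f : Circle → ℝ) :
    ∫ z, f z ∂(circleMeasure.withDensity (μ.rnDeriv circleMeasure)) =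
      ∫ z, (μ.rnDeriv circleMeasure z).toReal * f z ∂circleMeasure :=
  integral_withDensity_eq_integral_toReal_smul (Measure.measurable_rnDeriv _ _)
    (Measure.rnDeriv_lt_top _ _) f

theorem integral_rnDeriv_mul_le {f : Circle → ℝ} (hf : Continuous f) (hf0 : ∀ z, 0 ≤ f z) :
    ∫ z, (μ.rnDeriv circleMeasure z).toReal * f z ∂circleMeasure ≤ ∫ z, f z ∂μ := by
  rw [← integral_withDensity_rnDeriv]
  exact integral_mono_measure (Measure.withDensity_rnDeriv_le _ _) (Eventually.of_forall hf0)
    (integrable_of_continuous hf)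

/-- The inequality log x ≤ x - 1 is applied to x = w |Φₙ|² / ‖Φₙ‖². The bound is uniform in n
because w dθ/2π ≤ μ makes the integral of x at most 1. -/
theorem exists_le_finiteSzegoIntegral_of_lintegral_lt_top (hμ : IsNontrivial μ)
    (h : ∫⁻ z, negPartIntegrand μ z ∂circleMeasure < ⊤) :
    ∃ M : ℝ, ∀ n, -M ≤ finiteSzegoIntegral μ n := by
  set W : Circle → ℝ := fun z => (μ.rnDeriv circleMeasure z).toReal
  have hWm : Measurable W := (Measure.measurable_rnDeriv _ _).ennreal_toReal
  -- Where the weight vanishes the integrand is 0 whatever w is, so positivity of w is needed only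
  -- elsewhere.
  have hpos : ∀ᵐ z ∂circleMeasure, cosWeight z = 0 ∨
      (μ.rnDeriv circleMeasure z ≠ 0 ∧ μ.rnDeriv circleMeasure z ≠ ⊤) := by
    filter_upwards [ae_lt_top (measurable_negPartIntegrand μ) h.ne,
      Measure.rnDeriv_lt_top μ circleMeasure] with z hz hz'
    by_cases hc : cosWeight z = 0
    · exact Or.inl hc
    · exact Or.inr ⟨fun h0 => hz.ne (negPartIntegrand_of_eq_zero h0 hc), hz'.ne⟩
  have hu : Integrable (fun z => cosWeight z * Real.log (W z)) circleMeasure := by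
    refine ⟨(continuous_cosWeight.measurable.mul hWm.log).aestronglyMeasurable, ?_⟩
    have hfin : ∫⁻ z, (2 * μ.rnDeriv circleMeasure z + negPartIntegrand μ z) ∂circleMeasure < ⊤ := by
      rw [lintegral_add_right _ (measurable_negPartIntegrand μ),
        lintegral_const_mul _ (Measure.measurable_rnDeriv _ _)]
      exact ENNReal.add_lt_top.2
        ⟨ENNReal.mul_lt_top (by simp) (Measure.lintegral_rnDeriv_lt_top _ _), h⟩
    refine (lintegral_mono_ae ?_).trans_lt hfin
    filter_upwards [hpos] with z hz
    rcases hz with hz | ⟨hz0, hzt⟩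
    · simp [hz]
    · rcases le_total 0 (cosWeight z * Real.log (W z)) with hs | hs
      · rw [Real.enorm_of_nonneg hs]
        refine le_trans ?_ le_self_add
        have := cosWeight_mul_log_toENNReal_le z (μ.rnDeriv circleMeasure z)
        rwa [ENNReal.log_pos_real hz0 hzt, ← EReal.coe_mul, EReal.real_coe_toENNReal] at this
      · rw [← enorm_neg, Real.enorm_of_nonneg (neg_nonneg.2 hs),
          negPartIntegrand_of_pos hz0 hzt]
        exact le_add_self
  refine ⟨1 - ∫ z, cosWeight z * Real.log (W z) ∂circleMeasure, fun n => ?_⟩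
  have hΦ : ∀ z : Circle, 0 < ‖(monicOP μ n).eval (z : ℂ)‖ ^ 2 := fun z =>
    pow_pos (norm_pos_iff.2 (eval_monicOP_circle_ne_zero hμ n z)) _
  have hΦc : Continuous fun z : Circle => ‖(monicOP μ n).eval (z : ℂ)‖ ^ 2 :=
    (continuous_eval_circle _).norm.pow 2
  have hc := sqNorm_pos hμ (monicOP_ne_zero (μ := μ) n)
  set c := sqNorm μ (monicOP μ n)
  have hlogΦ := continuous_log_norm_eval_sq (eval_monicOP_circle_ne_zero hμ n)
  have hw := continuous_cosWeight
  have hwΦ : Continuous fun z : Circle =>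
      cosWeight z * Real.log (‖(monicOP μ n).eval (z : ℂ)‖ ^ 2) := continuous_cosWeight.mul hlogΦ
  have huΦ : Integrable (fun z : Circle => cosWeight z * Real.log (W z) +
      cosWeight z * Real.log (‖(monicOP μ n).eval (z : ℂ)‖ ^ 2)) circleMeasure :=
    hu.add (integrable_of_continuous hwΦ)
  have key : ∫ z : Circle, (cosWeight z * Real.log (W z) +
      cosWeight z * Real.log (‖(monicOP μ n).eval (z : ℂ)‖ ^ 2) -
      cosWeight z * Real.log c) ∂circleMeasure ≤
      ∫ z : Circle, (2 * c⁻¹ * (W z * ‖(monicOP μ n).eval (z : ℂ)‖ ^ 2) - cosWeight z)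
        ∂circleMeasure := by
    refine integral_mono_ae (huΦ.sub
      (integrable_of_continuous (by fun_prop)))
      (((integrable_rnDeriv_mul_of_continuous hΦc).const_mul _).sub
        (integrable_of_continuous hw)) ?_
    filter_upwards [hpos] with z hz
    have hWΦ : 0 ≤ c⁻¹ * (W z * ‖(monicOP μ n).eval (z : ℂ)‖ ^ 2) :=
      mul_nonneg (inv_nonneg.2 hc.le) (mul_nonneg ENNReal.toReal_nonneg (hΦ z).le)
    rcases hz with hz | ⟨hz0, hzt⟩
    · simp only [hz, zero_mul, add_zero, sub_zero]
      linarith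
    · have hWz : 0 < W z := ENNReal.toReal_pos hz0 hzt
      have hlog := Real.log_le_sub_one_of_pos
        (mul_pos (inv_pos.2 hc) (mul_pos hWz (hΦ z)))
      rw [Real.log_mul (inv_pos.2 hc).ne' (mul_pos hWz (hΦ z)).ne', Real.log_inv,
        Real.log_mul hWz.ne' (hΦ z).ne'] at hlog
      have h1 := mul_le_mul_of_nonneg_left hlog (cosWeight_nonneg z)
      have h2 := mul_le_mul_of_nonneg_right (cosWeight_le_two z) hWΦ
      linarith
  rw [integral_sub huΦ (integrable_of_continuous (by fun_prop)),
    integral_add hu (integrable_of_continuous hwΦ), integral_mul_const, integral_cosWeight,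
    integral_cosWeight_mul_log_monicOP hμ,
    integral_sub ((integrable_rnDeriv_mul_of_continuous hΦc).const_mul _)
      (integrable_of_continuous hw), integral_cosWeight, integral_const_mul] at key
  have hle : ∫ z : Circle, W z * ‖(monicOP μ n).eval (z : ℂ)‖ ^ 2 ∂circleMeasure ≤ c :=
    integral_rnDeriv_mul_le hΦc fun z => (hΦ z).le
  have h2 := mul_le_mul_of_nonneg_left hle (by positivity : 0 ≤ 2 * c⁻¹)
  rw [mul_assoc 2 c⁻¹ c, inv_mul_cancel₀ hc.ne', mul_one] at h2
  linarith

/-- Integral bound for a bounded measurable test function, comparable to the truncated reciprocal of the density. -/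
theorem integral_cosWeight_mul_truncated_le {s : Set Circle}
    [DecidablePred (· ∈ s)] (hs : MeasurableSet s)
    (hsing : μ.singularPart circleMeasure s = 0) {δ : ℝ} (hδ : 0 < δ) (hδ1 : δ ≤ 1)
    {g : Circle → ℝ} (hg : g = s.piecewise
      (fun z => (max δ (min (μ.rnDeriv circleMeasure z).toReal 1))⁻¹) fun _ => 1) :
    Measurable g ∧ (∀ z, 1 ≤ g z) ∧ (∀ z, g z ≤ δ⁻¹) ∧ ∫ z, cosWeight z * g z ∂μ ≤ 6 := by
  set W : Circle → ℝ := fun z => (μ.rnDeriv circleMeasure z).toReal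
  have hWm : Measurable W := (Measure.measurable_rnDeriv _ _).ennreal_toReal
  have hW0 : ∀ z, 0 ≤ W z := fun z => ENNReal.toReal_nonneg
  have hgm : Measurable g := by
    rw [hg]
    exact ((measurable_const.max (hWm.min measurable_const)).inv).piecewise hs measurable_const
  have hcl : ∀ z, δ ≤ max δ (min (W z) 1) ∧ max δ (min (W z) 1) ≤ 1 := fun z =>
    ⟨le_max_left _ _, max_le hδ1 (min_le_right _ _)⟩
  have hg1 : ∀ z, 1 ≤ g z := fun z => by
    rw [hg]
    by_cases hz : z ∈ s
    · rw [Set.piecewise_eq_of_mem _ _ _ hz]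
      exact (one_le_inv₀ (hδ.trans_le (hcl z).1)).2 (hcl z).2
    · rw [Set.piecewise_eq_of_notMem _ _ _ hz]
  have hgδ : ∀ z, g z ≤ δ⁻¹ := fun z => by
    rw [hg]
    by_cases hz : z ∈ s
    · rw [Set.piecewise_eq_of_mem _ _ _ hz]
      exact inv_anti₀ hδ (hcl z).1
    · rw [Set.piecewise_eq_of_notMem _ _ _ hz]
      exact (one_le_inv₀ hδ).2 hδ1
  refine ⟨hgm, hg1, hgδ, ?_⟩
  -- On s the truncated density is at least W if W ≤ 1 and at least 1 otherwise, so W g is at most 1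
  -- or W respectively.
  have hWg : ∀ z, W z * g z ≤ 1 + W z := fun z => by
    rw [hg]
    by_cases hz : z ∈ s
    · rw [Set.piecewise_eq_of_mem _ _ _ hz, mul_inv_le_iff₀ (hδ.trans_le (hcl z).1)]
      rcases le_total (W z) 1 with h1 | h1
      · have : W z ≤ max δ (min (W z) 1) := by rw [min_eq_left h1]; exact le_max_right _ _
        nlinarith [hW0 z, (hcl z).1]
      · have : 1 ≤ max δ (min (W z) 1) := by rw [min_eq_right h1]; exact le_max_right _ _
        nlinarith [hW0 z]
    · rw [Set.piecewise_eq_of_notMem _ _ _ hz]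
      linarith
  have hint : ∀ (ρ : Measure Circle) [IsFiniteMeasure ρ],
      Integrable (fun z => cosWeight z * g z) ρ := fun ρ _ =>
    (Integrable.of_bound hgm.aestronglyMeasurable δ⁻¹ (Eventually.of_forall fun z => by
      rw [Real.norm_eq_abs, abs_of_nonneg (by linarith [hg1 z])]; exact hgδ z)).bdd_mul
      continuous_cosWeight.aestronglyMeasurable (Eventually.of_forall norm_cosWeight_le_two)
  -- The bound 6 is 2 + 4. The singular part, of mass at most 1, lives off s, where g = 1 and the
  -- weight is at most 2; the other part is at most ∫ 2(1 + W) ≤ 4.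
  have hdec : ∫ z, cosWeight z * g z ∂μ = ∫ z, cosWeight z * g z ∂(μ.singularPart circleMeasure) +
      ∫ z, cosWeight z * g z ∂(circleMeasure.withDensity (μ.rnDeriv circleMeasure)) := by
    rw [← integral_add_measure (hint _) (hint _), ← Measure.haveLebesgueDecomposition_add]
  have hI1 : ∫ z, cosWeight z * g z ∂(μ.singularPart circleMeasure) ≤ 2 := by
    have hle : ∫ z, cosWeight z * g z ∂(μ.singularPart circleMeasure) ≤
        ∫ _, 2 ∂(μ.singularPart circleMeasure) := by
      refine integral_mono_ae (hint _) (integrable_const _) ?_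
      have hns : ∀ᵐ z ∂(μ.singularPart circleMeasure), z ∉ s := measure_eq_zero_iff_ae_notMem.1 hsing
      filter_upwards [hns] with z hz
      rw [hg, Set.piecewise_eq_of_notMem _ _ _ hz, mul_one]
      exact cosWeight_le_two z
    rw [integral_const, smul_eq_mul] at hle
    have hmass : (μ.singularPart circleMeasure).real Set.univ ≤ 1 := by
      have := ENNReal.toReal_mono (measure_ne_top μ _)
        (Measure.singularPart_le μ circleMeasure Set.univ)
      rw [measure_univ (μ := μ), ENNReal.toReal_one] at this
      exact this
    linarith
  have hI2 : ∫ z, cosWeight z * g z ∂(circleMeasure.withDensity (μ.rnDeriv circleMeasure)) ≤ 4 := by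
    rw [integral_withDensity_rnDeriv]
    have hWi : Integrable W circleMeasure := Measure.integrable_toReal_rnDeriv
    have hle : ∫ z, W z * (cosWeight z * g z) ∂circleMeasure ≤
        ∫ z, 2 * (1 + W z) ∂circleMeasure := by
      refine integral_mono_of_nonneg (Eventually.of_forall fun z => mul_nonneg (hW0 z)
        (mul_nonneg (cosWeight_nonneg z) (by linarith [hg1 z])))
        (((integrable_const 1).add hWi).const_mul 2) (Eventually.of_forall fun z => ?_)
      have h1 := mul_le_mul_of_nonneg_left (hWg z) (cosWeight_nonneg z)
      have h2 := mul_le_mul_of_nonneg_right (cosWeight_le_two z)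
        (by linarith [hW0 z] : 0 ≤ 1 + W z)
      dsimp only
      linarith
    rw [integral_const_mul, integral_add (integrable_const 1) hWi] at hle
    have hW1 := integral_rnDeriv_mul_le (μ := μ) (f := fun _ => 1) continuous_const
      fun _ => zero_le_one
    simp only [mul_one] at hW1
    simp at hW1 hle
    linarith
  linarith

/-- The set s carries Lebesgue measure and is null for the singular part. Test functions equal to
truncations of 1/w on s and 1 elsewhere keep the right side of the variational inequality bounded,
and Fatou removes the truncation. -/
theorem lintegral_lt_top_of_le_finiteSzegoIntegral (hμ : IsNontrivial μ) {M : ℝ}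
    (hM : ∀ n, -M ≤ finiteSzegoIntegral μ n) :
    ∫⁻ z, negPartIntegrand μ z ∂circleMeasure < ⊤ := by
  classical
  obtain ⟨s, hs, hsing, hscompl⟩ := Measure.mutuallySingular_singularPart μ circleMeasure
  set g : ℕ → Circle → ℝ := fun k => s.piecewise
      (fun z => (max (1 / ((k : ℝ) + 1)) (min (μ.rnDeriv circleMeasure z).toReal 1))⁻¹) fun _ => 1
    with hg
  have hgk := fun k : ℕ => integral_cosWeight_mul_truncated_le hs hsing
    (by positivity : 0 < 1 / ((k : ℝ) + 1))
    (by rw [div_le_one (by positivity)]; linarith [(Nat.cast_nonneg k : (0 : ℝ) ≤ k)])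
    (rfl : g k = _)
  have hmeas : ∀ k, Measurable fun z => ENNReal.ofReal (cosWeight z * Real.log (g k z)) := fun k =>
    (continuous_cosWeight.measurable.mul (hgk k).1.log).ennreal_ofReal
  -- Here 5 + M is 6 + M - 1, with 6 from `integral_cosWeight_mul_truncated_le`.
  have hbound : ∀ k, ∫⁻ z, ENNReal.ofReal (cosWeight z * Real.log (g k z)) ∂circleMeasure ≤
      ENNReal.ofReal (5 + M) := fun k => by
    obtain ⟨hgm, hg1, hgK, hg6⟩ := hgk k
    have hlogg : Integrable (fun z => cosWeight z * Real.log (g k z)) circleMeasure :=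
      (Integrable.of_bound hgm.log.aestronglyMeasurable (Real.log (1 / ((k : ℝ) + 1))⁻¹)
        (Eventually.of_forall fun z => by
          rw [Real.norm_eq_abs, abs_of_nonneg (Real.log_nonneg (hg1 z))]
          exact Real.log_le_log (by linarith [hg1 z]) (hgK z))).bdd_mul
        continuous_cosWeight.aestronglyMeasurable (Eventually.of_forall norm_cosWeight_le_two)
    rw [← ofReal_integral_eq_lintegral_ofReal hlogg (Eventually.of_forall fun z =>
      mul_nonneg (cosWeight_nonneg z) (Real.log_nonneg (hg1 z)))]
    refine ENNReal.ofReal_le_ofReal ?_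
    have := integral_cosWeight_mul_log_le_of_bounded hμ hM hgm hg1 hgK
    linarith
  have hfatou := lintegral_liminf_le (μ := circleMeasure) (u := atTop) hmeas
  have hle : ∫⁻ z, negPartIntegrand μ z ∂circleMeasure ≤
      ∫⁻ z, liminf (fun k => ENNReal.ofReal (cosWeight z * Real.log (g k z))) atTop
        ∂circleMeasure := by
    refine lintegral_mono_ae ?_
    have hns : ∀ᵐ z ∂circleMeasure, z ∉ sᶜ := measure_eq_zero_iff_ae_notMem.1 hscompl
    filter_upwards [hns, Measure.rnDeriv_lt_top μ circleMeasure] with z hz hzt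
    have hz' : z ∈ s := by simpa using hz
    have hgz : ∀ k, g k z =
        (max (1 / ((k : ℝ) + 1)) (min (μ.rnDeriv circleMeasure z).toReal 1))⁻¹ := fun k =>
      Set.piecewise_eq_of_mem _ _ _ hz'
    simp only [hgz]
    exact negPartIntegrand_le_liminf hzt.ne
  refine (hle.trans hfatou).trans_lt (lt_of_le_of_lt ?_ (ENNReal.ofReal_lt_top (r := 5 + M)))
  exact (liminf_le_liminf (Eventually.of_forall hbound)).trans_eq (liminf_const _)

end Density

/-! ### The finite sum rule -/

section SumRule

open Filter Topology

theorem log_one_sub_add_le {x : ℝ} (h0 : 0 ≤ x) (h1 : x < 1) :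
    Real.log (1 - x) + x ≤ -(x ^ 2 / 2) := by
  have h := Real.hasSum_pow_div_log_of_abs_lt_one (x := x) (by rwa [abs_of_nonneg h0])
  have h2 := sum_le_hasSum (Finset.range 2) (fun i _ => by positivity) h
  simp only [Finset.sum_range_succ, Finset.sum_range_zero] at h2
  norm_num at h2
  linarith

theorem neg_le_log_one_sub_add {x : ℝ} (h0 : 0 ≤ x) (h1 : x ≤ 1 / 2) :
    -(2 * x ^ 2) ≤ Real.log (1 - x) + x := by
  have h := (abs_le.1 (Real.abs_log_sub_add_sum_range_le (x := x)
    (by rw [abs_of_nonneg h0]; linarith) 1)).1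
  simp only [Finset.sum_range_one] at h
  rw [abs_of_nonneg h0] at h
  norm_num at h
  have h3 : x ^ 2 / (1 - x) ≤ 2 * x ^ 2 := by
    rw [div_le_iff₀ (by linarith)]
    nlinarith [sq_nonneg x]
  linarith

variable {μ : Measure Circle} [IsProbabilityMeasure μ]

/-- The norm ratio gives the logarithm; the subleading coefficient changes by conj αₙ₊₁ αₙ because
Φₙ₊₁(0) = -conj αₙ. The index starts at 1 since Φ₀(0) = 1 is not of this form for any earlier
coefficient. -/
theorem finiteSzegoIntegral_succ_succ (hμ : IsNontrivial μ) (n : ℕ) :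
    finiteSzegoIntegral μ (n + 2) = finiteSzegoIntegral μ (n + 1) +
      (Real.log (1 - ‖verblunsky μ (n + 1)‖ ^ 2) +
        (conj (verblunsky μ (n + 1)) * verblunsky μ n).re) := by
  have h1 : 0 < 1 - ‖verblunsky μ (n + 1)‖ ^ 2 := by
    nlinarith [norm_verblunsky_lt_one hμ (n + 1), norm_nonneg (verblunsky μ (n + 1))]
  rw [finiteSzegoIntegral, finiteSzegoIntegral, sqNorm_monicOP_succ hμ (n + 1),
    Real.log_mul h1.ne' (sqNorm_pos hμ (monicOP_ne_zero _)).ne', nextCoeff_monicOP_succ hμ (n + 1),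
    monicOP_succ_coeff_zero, map_neg, Complex.conj_conj, mul_neg, sub_neg_eq_add, Complex.add_re]
  ring

/-- The increments in the finite sum rule for `∫ (1 - cos θ) log w dθ/2π`. -/
def sumRuleTerm (μ : Measure Circle) (n : ℕ) : ℝ :=
  ‖verblunsky μ (n + 1) - verblunsky μ n‖ ^ 2 / 2 -
    (Real.log (1 - ‖verblunsky μ (n + 1)‖ ^ 2) + ‖verblunsky μ (n + 1)‖ ^ 2)

/-- Polarization of Re(conj αₙ₊₁ αₙ) leaves (|αₙ|² - |αₙ₊₁|²)/2, which telescopes into the boundary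
terms. -/
theorem finiteSzegoIntegral_succ_eq (hμ : IsNontrivial μ) (n : ℕ) :
    finiteSzegoIntegral μ (n + 1) + ‖verblunsky μ n‖ ^ 2 / 2 =
      finiteSzegoIntegral μ 1 + ‖verblunsky μ 0‖ ^ 2 / 2 -
        ∑ j ∈ Finset.range n, sumRuleTerm μ j := by
  induction n with
  | zero => simp
  | succ n ih =>
    rw [Finset.sum_range_succ, finiteSzegoIntegral_succ_succ hμ]
    have h : ‖verblunsky μ (n + 1) - verblunsky μ n‖ ^ 2 = ‖verblunsky μ (n + 1)‖ ^ 2 +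
        ‖verblunsky μ n‖ ^ 2 - 2 * (conj (verblunsky μ (n + 1)) * verblunsky μ n).re := by
      simp only [← Complex.normSq_eq_norm_sq, Complex.normSq_apply, Complex.sub_re, Complex.sub_im,
        Complex.mul_re, Complex.conj_re, Complex.conj_im]
      ring
    have := sumRuleTerm.eq_def μ n
    linarith

theorem le_sumRuleTerm (hμ : IsNontrivial μ) (n : ℕ) :
    ‖verblunsky μ (n + 1) - verblunsky μ n‖ ^ 2 / 2 + ‖verblunsky μ (n + 1)‖ ^ 4 / 2 ≤
      sumRuleTerm μ n := by
  have h1 := norm_verblunsky_lt_one hμ (n + 1)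
  have h0 := norm_nonneg (verblunsky μ (n + 1))
  have := log_one_sub_add_le (sq_nonneg ‖verblunsky μ (n + 1)‖) (by nlinarith)
  unfold sumRuleTerm
  nlinarith

theorem sumRuleTerm_nonneg (hμ : IsNontrivial μ) (n : ℕ) : 0 ≤ sumRuleTerm μ n :=
  le_trans (by positivity) (le_sumRuleTerm hμ n)

theorem summable_sumRuleTerm_iff (hμ : IsNontrivial μ) :
    Summable (sumRuleTerm μ) ↔
      Summable (fun j : ℕ => ‖verblunsky μ (j + 1) - verblunsky μ j‖ ^ 2) ∧
        Summable (fun j : ℕ => ‖verblunsky μ j‖ ^ 4) := by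
  constructor
  · intro h
    refine ⟨Summable.of_nonneg_of_le (fun _ => by positivity) (fun n => ?_) (h.mul_left 2),
      (summable_nat_add_iff 1).1 (Summable.of_nonneg_of_le (fun _ => by positivity)
        (fun n => ?_) (h.mul_left 2))⟩
    all_goals
      have h1 := le_sumRuleTerm hμ n
      have h2 : 0 ≤ ‖verblunsky μ (n + 1) - verblunsky μ n‖ ^ 2 := by positivity
      have h3 : 0 ≤ ‖verblunsky μ (n + 1)‖ ^ 4 := by positivity
      linarith
  · rintro ⟨h1, h2⟩
    have h2' := (summable_nat_add_iff 1).2 h2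
    refine Summable.of_norm_bounded_eventually_nat ((h1.div_const 2).add (h2'.mul_left 2)) ?_
    -- Eventually |α|⁴ < 1/4, that is |α|² < 1/2, the range in which the lower bound for log(1 - x)
    -- + x holds.
    have ht := h2'.tendsto_atTop_zero.eventually_lt_const (by norm_num : (0 : ℝ) < 1 / 4)
    filter_upwards [ht] with n hn
    rw [Real.norm_eq_abs, abs_of_nonneg (sumRuleTerm_nonneg hμ n)]
    have hx : ‖verblunsky μ (n + 1)‖ ^ 2 ≤ 1 / 2 := by
      nlinarith [sq_nonneg (‖verblunsky μ (n + 1)‖ ^ 2)]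
    have := neg_le_log_one_sub_add (sq_nonneg _) hx
    unfold sumRuleTerm
    nlinarith

/-- The finite sum rule: the integrals for the Bernstein-Szegő approximations are bounded below
exactly when the Verblunsky coefficients satisfy the summability conditions. -/
theorem exists_le_finiteSzegoIntegral_iff (hμ : IsNontrivial μ) :
    (∃ M : ℝ, ∀ n, -M ≤ finiteSzegoIntegral μ n) ↔
      Summable (fun j : ℕ => ‖verblunsky μ (j + 1) - verblunsky μ j‖ ^ 2) ∧
        Summable (fun j : ℕ => ‖verblunsky μ j‖ ^ 4) := by
  rw [← summable_sumRuleTerm_iff hμ]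
  constructor
  · rintro ⟨M, hM⟩
    refine summable_of_sum_range_le (sumRuleTerm_nonneg hμ)
      (c := finiteSzegoIntegral μ 1 + ‖verblunsky μ 0‖ ^ 2 / 2 + M) fun n => ?_
    have h1 := finiteSzegoIntegral_succ_eq hμ n
    have h2 := hM (n + 1)
    have h3 : 0 ≤ ‖verblunsky μ n‖ ^ 2 := by positivity
    linarith
  · intro h
    -- The sum rule covers indices from 1 on, so index 0 enters separately; 1/2 bounds the boundary
    -- term |αₙ|²/2.
    refine ⟨max (-finiteSzegoIntegral μ 0) (1 / 2 + ∑' j, sumRuleTerm μ j -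
      (finiteSzegoIntegral μ 1 + ‖verblunsky μ 0‖ ^ 2 / 2)), fun n => ?_⟩
    rw [neg_le]
    cases n with
    | zero => exact le_max_left _ _
    | succ n =>
      refine le_trans ?_ (le_max_right _ _)
      have h1 := finiteSzegoIntegral_succ_eq hμ n
      have h2 := h.sum_le_tsum (Finset.range n) fun i _ => sumRuleTerm_nonneg hμ i
      have h3 : ‖verblunsky μ n‖ ^ 2 ≤ 1 :=
        pow_le_one₀ (norm_nonneg _) (norm_verblunsky_lt_one hμ n).le
      linarith

end SumRule

end

end OPUC

theorem theorem2p1 (μ : MeasureTheory.Measure Circle) [MeasureTheory.IsProbabilityMeasure μ]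
    (hμ : OPUC.IsNontrivial μ) :
    (Summable (fun j : ℕ => ‖OPUC.verblunsky μ (j + 1) - OPUC.verblunsky μ j‖ ^ 2) ∧
      Summable (fun j : ℕ => ‖OPUC.verblunsky μ j‖ ^ 4)) ↔
    ⊥ < OPUC.higherSzegoIntegral μ := by
  rw [OPUC.bot_lt_higherSzegoIntegral_iff, ← OPUC.exists_le_finiteSzegoIntegral_iff hμ]
  exact ⟨fun ⟨_, hM⟩ => OPUC.lintegral_lt_top_of_le_finiteSzegoIntegral hμ hM,
    OPUC.exists_le_finiteSzegoIntegral_of_lintegral_lt_top hμ⟩
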